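/- Let $\mathbb F_q$ be a finite field with $q$ elements, whose elements are identified with the digits $0,\dots,q-1$ by an arbitrary bijection, and let $0\le k\le n$. For a $k$-dimensional subspace $X$ of $\mathbb F_q^n$ let $\mathrm{RE}(X)$ be its $k\times n$ basis matrix in reduced row echelon form. Number the columns of $\mathrm{RE}(X)$ without a leading coefficient from right to left by $1,\dots,n-k$; the Ferrers diagram $\mathcal F_X=(\mathcal F_{n-k},\dots,\mathcal F_1)$ has in column $i$ as many dots $\mathcal F_i$ as there are rows whose leading coefficient is to the left of the $i$-th of these columns. The Ferrers tableaux form $\mathcal F(X)$ fills these dots with the corresponding entries of $\mathrm{RE}(X)$; its entries vector $x=(x_1,x_2,\dots)$ lists them column by column from right to left, each column from top to bottom, and $\{x\}$ is its value as a base-$q$ number with most significant digit $x_1$. Write $|\mathcal F_X|=\sum_i\mathcal F_i$. Order the subspaces by: $X<Y$ if $|\mathcal F_X|>|\mathcal F_Y|$; or $|\mathcal F_X|=|\mathcal F_Y|$ and the diagram of $X$ has more dots than that of $Y$ in the least column $i$ in which they differ; or $\mathcal F_X=\mathcal F_Y$ and $\{x\}<\{y\}$. Let $\mathrm{Ind}_{\mathcal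 F}(X)$ be the number of subspaces preceding $X$. For nonnegative integers $a,b,m$ let $p(a,b,m)$ be the number of partitions of $m$ whose Ferrers diagram fits into an $a\times b$ box; put $\alpha_m=p(k,n-k,m)$. Encoding Algorithm C, on input an index $0\le i<\binom{n}{k}_q=\prod_{j=0}^{k-1}\frac{q^{n-j}-1}{q^{k-j}-1}$ given by its base-$q$ digits, works as follows. It first tabulates $p(a,b,m)$ for $a\le k$, $b\le n-k$, $m\le k(n-k)$ by the recurrence $p(a,b,m)=p(a,b-1,m-a)+p(a-1,b,m)$ for $a,b,m\ge1$ (the first term being $0$ if $m<a$), with $p(a,b,0)=1$ and $p(a,b,m)=0$ if $ab=0<m$. It sets $i_0=i$ and for $j=0,1,\dots,k(n-k)$, with $m=k(n-k)-j$: if $i_j\ge\alpha_mq^m$ it sets $i_{j+1}=i_j-\alpha_mq^m$ and continues; otherwise it writes $i_j=hq^m+r$ with $0\le r<q^m$, determines the diagram $\mathcal F=(\mathcal F_{n-k},\dots,\mathcal F_1)$ of size $m$ with index $h$ as described next, lets $x$ be the base-$q$ representation of $r$ with $m$ digits, outputs $(\mathcal F,x)$ and stops. The diagram is found column by column: put $\mathcal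 F_0=k$; for $j=1,\dots,n-k$, if $j\ge2$ and $\mathcal F_1+\dots+\mathcal F_{j-1}=m$ set $\mathcal F_j=0$; otherwise start with $a=\mathcal F_{j-1}$ and, while $h\ge N(a):=p(a,n-k-j,m-\mathcal F_1-\dots-\mathcal F_{j-1}-a)$ (read from the table, and $0$ if the last argument is negative), replace $h$ by $h-N(a)$ and $a$ by $a-1$; then set $\mathcal F_j=a$. Cost is counted in digit operations: adding, subtracting, comparing, reading or writing one $q$-ary digit costs one operation; multiplication by, and division with remainder by, a power of $q$ are shifts charged by the number of digits moved; operations on loop counters and table addresses are charged by the numbers of $q$-ary digits of the operands (the single multiplication $k\cdot(n-k)$ as schoolbook multiplication). Theorem. For all $0\le k\le n$ and every $0\le i<\binom{n}{k}_q$, the output of Encoding Algorithm C on input $i$ is the Ferrers tableaux form of exactly one $k$-dimensional subspace $X$ of $\mathbb F_q^n$, and $\mathrm{Ind}_{\mathcal F}(X)=i$. Moreover there is an absolute constant $C$ such that, for all $q$, all $0<k<n$ and all such $i$, the algorithm uses at most $C\,k^{5/2}(n-k)^{5/2}$ digit operations. -/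

import Mathlib

/-! ## The Grassmannian, reduced row echelon forms and Ferrers tableaux forms -/

/-- The Grassmannian: all `k`-dimensional subspaces of `F ^ n`. -/
abbrev Grass (F : Type*) [Field F] (n k : ℕ) : Type _ :=
  {X : Submodule F (Fin n → F) // Module.finrank F X = k}

/-- The `q`-ary Gaussian coefficient `∏_{i < k} (q ^ (n - i) - 1) / (q ^ (k - i) - 1)`.
For `k > n` the factor `i = n` makes the product `0`. -/
def gaussCoeff (q n k : ℕ) : ℚ :=
  ∏ i ∈ Finset.range k, ((q : ℚ) ^ (n - i) - 1) / ((q : ℚ) ^ (k - i) - 1)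

/-- `M` is a `k × n` matrix in reduced row echelon form without zero rows, the leading
coefficient of row `r` being in column `piv r`. -/
structure IsRREF {F : Type*} [Field F] {n k : ℕ} (M : Matrix (Fin k) (Fin n) F)
    (piv : Fin k → Fin n) : Prop where
  pivot_strictMono : StrictMono piv
  zero_left : ∀ r c, c < piv r → M r c = 0
  pivot_one : ∀ r, M r (piv r) = 1
  pivot_column : ∀ r s, s ≠ r → M s (piv r) = 0

/-- The columns without a leading coefficient, listed from right to left. -/
def freeColumns {n k : ℕ} (piv : Fin k → Fin n) : List (Fin n) :=
  (List.finRange n).reverse.filter fun c => decide (∀ r, piv r ≠ c)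

/-- The rows whose leading coefficient is to the left of column `c`, from top to bottom. -/
def rowsBefore {n k : ℕ} (piv : Fin k → Fin n) (c : Fin n) : List (Fin k) :=
  (List.finRange k).filter fun r => decide (piv r < c)

/-- The Ferrers diagram of a matrix in reduced row echelon form, as the list
`[𝓕₁, 𝓕₂, …, 𝓕_{n-k}]` of its column heights, the columns being numbered from right to left.
Row `r` of the diagram has one dot for each column without a leading coefficient that is to the
right of `piv r`; these dots are shifted to the right. -/
def diagramOf {n k : ℕ} (piv : Fin k → Fin n) : List ℕ :=
  (freeColumns piv).map fun c => (rowsBefore piv c).length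

/-- The entries vector `(x₁, x₂, …)` of the Ferrers tableaux form, the entries being numbered
column by column from right to left and in each column from top to bottom. The bijection `e`
turns field elements into digits `0, …, q - 1`. -/
def entriesOf {F : Type*} {q n k : ℕ} (e : F ≃ Fin q) (M : Matrix (Fin k) (Fin n) F)
    (piv : Fin k → Fin n) : List ℕ :=
  (freeColumns piv).flatMap fun c => (rowsBefore piv c).map fun r => (e (M r c) : ℕ)

/-- The Ferrers tableaux form of the subspace `X` has diagram `D` (column heights, from right to
left) and entries vector `x`. Each `X` has exactly one such pair `(D, x)`. -/
def HasTableauxForm {F : Type*} [Field F] {q n k : ℕ} (e : F ≃ Fin q) (X : Grass F n k)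
    (D x : List ℕ) : Prop :=
  ∃ (M : Matrix (Fin k) (Fin n) F) (piv : Fin k → Fin n), IsRREF M piv ∧
    Submodule.span F (Set.range M.row) = X.1 ∧ D = diagramOf piv ∧ x = entriesOf e M piv

/-- The value `{x}` of a vector of digits read as a number in base `q`, the first digit being the
most significant one. -/
def vecValue (q : ℕ) (x : List ℕ) : ℕ := Nat.ofDigits q x.reverse

/-- The order of Ferrers tableaux forms: larger diagrams first; among diagrams of the same size,
the one with more dots in the first column where they differ comes first; for equal diagrams,
by the value of the entries vector. -/
def TableauxLT (q : ℕ) (D x D' x' : List ℕ) : Prop :=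
  D'.sum < D.sum ∨
  (D.sum = D'.sum ∧ List.Lex (fun a b : ℕ => b < a) D D') ∨
  (D = D' ∧ vecValue q x < vecValue q x')

/-- The order of the Grassmannian induced by Ferrers tableaux forms. -/
def GrassLT {F : Type*} [Field F] {q n k : ℕ} (e : F ≃ Fin q) (X Y : Grass F n k) : Prop :=
  ∃ D x D' x', HasTableauxForm e X D x ∧ HasTableauxForm e Y D' x' ∧ TableauxLT q D x D' x'

/-- The lexicographic index of `X`: the number of subspaces that precede `X`. -/
noncomputable def indF {F : Type*} [Field F] {q n k : ℕ} (e : F ≃ Fin q) (X : Grass F n k) : ℕ :=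
  Nat.card {Y : Grass F n k // GrassLT e Y X}

/-! ## Counting digit operations

A program is an element of `Counted α`: its result together with the number of digit operations
spent. Programs are composed from the primitives below; each of them charges for every `q`-ary
digit that it adds, subtracts, multiplies, compares, reads or writes. Large integers are lists of
digits with the least significant digit first. Loop counters and table addresses are natural
numbers, and operations on them are charged by the lengths of their `q`-ary representations. -/

structure Counted (α : Type) where
  val : α
  cost : ℕ

namespace Counted

instance : Monad Counted where
  pure a := ⟨a, 0⟩
  bind x f := ⟨(f x.val).val, x.cost + (f x.val).cost⟩

/-! ### Operations on single digits -/

/-- Full adder: the sum digit and the carry. -/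
def digitAdd (q a b c : ℕ) : Counted (ℕ × ℕ) :=
  ⟨((a + b + c) % q, (a + b + c) / q), 1⟩

/-- Full subtractor: the difference digit and the borrow. -/
def digitSub (q a b c : ℕ) : Counted (ℕ × ℕ) :=
  ⟨if b + c ≤ a then (a - (b + c), 0) else (a + q - (b + c), 1), 1⟩

def digitCmp (a b : ℕ) : Counted Ordering := ⟨compare a b, 1⟩

def digitWrite (a : ℕ) : Counted ℕ := ⟨a, 1⟩

/-! ### Operations on indices -/

/-- The number of `q`-ary digits of an index. -/
def idxLen (q a : ℕ) : ℕ := (Nat.digits q a).length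

def idxAdd (q a b : ℕ) : Counted ℕ := ⟨a + b, idxLen q a + idxLen q b + 1⟩

/-- Subtraction of indices, used only for `b ≤ a`. -/
def idxSub (q a b : ℕ) : Counted ℕ := ⟨a - b, idxLen q a + idxLen q b + 1⟩

/-- Schoolbook multiplication of indices. -/
def idxMul (q a b : ℕ) : Counted ℕ := ⟨a * b, 2 * (idxLen q a + 1) * (idxLen q b + 1)⟩

def idxLt (q a b : ℕ) : Counted Bool := ⟨decide (a < b), idxLen q a + idxLen q b + 1⟩

def idxEq (q a b : ℕ) : Counted Bool := ⟨decide (a = b), idxLen q a + idxLen q b + 1⟩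

def idxWrite (q a : ℕ) : Counted ℕ := ⟨a, idxLen q a + 1⟩

/-! ### Operations on large integers -/

/-- Addition with an incoming carry. -/
def qAddCarry (q : ℕ) : List ℕ → List ℕ → ℕ → Counted (List ℕ)
  | [], [], c => do
    match ← digitCmp c 0 with
    | .eq => pure []
    | _ => do
      let d ← digitWrite c
      pure [d]
  | a :: as, [], c => do
    let s ← digitAdd q a 0 c
    let r ← qAddCarry q as [] s.2
    pure (s.1 :: r)
  | [], b :: bs, c => do
    let s ← digitAdd q 0 b c
    let r ← qAddCarry q [] bs s.2
    pure (s.1 :: r)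
  | a :: as, b :: bs, c => do
    let s ← digitAdd q a b c
    let r ← qAddCarry q as bs s.2
    pure (s.1 :: r)

def qAdd (q : ℕ) (x y : List ℕ) : Counted (List ℕ) := qAddCarry q x y 0

/-- Subtraction with an incoming borrow, used only where the result is nonnegative and the
subtrahend is not longer than the minuend. -/
def qSubBorrow (q : ℕ) : List ℕ → List ℕ → ℕ → Counted (List ℕ)
  | [], _, _ => pure []
  | a :: as, [], c => do
    let s ← digitSub q a 0 c
    let r ← qSubBorrow q as [] s.2
    pure (s.1 :: r)
  | a :: as, b :: bs, c => do
    let s ← digitSub q a b c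
    let r ← qSubBorrow q as bs s.2
    pure (s.1 :: r)

def qSub (q : ℕ) (x y : List ℕ) : Counted (List ℕ) := qSubBorrow q x y 0

/-- The verdict on `x < y` after one more significant digit has been compared. -/
def updateVerdict (r : Bool) : Ordering → Bool
  | .lt => true
  | .eq => r
  | .gt => false

/-- Comparison, where `r` is the verdict of the less significant digits. -/
def qLessAux : List ℕ → List ℕ → Bool → Counted Bool
  | [], [], r => pure r
  | a :: as, [], r => do
    let o ← digitCmp a 0
    qLessAux as [] (updateVerdict r o)
  | [], b :: bs, r => do
    let o ← digitCmp 0 b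
    qLessAux [] bs (updateVerdict r o)
  | a :: as, b :: bs, r => do
    let o ← digitCmp a b
    qLessAux as bs (updateVerdict r o)

/-- The test `x < y`. -/
def qLess (x y : List ℕ) : Counted Bool := qLessAux x y false

/-- Multiplication by `q ^ m`: a shift by `m` digits. -/
def qShift (m : ℕ) (x : List ℕ) : Counted (List ℕ) :=
  ⟨List.replicate m 0 ++ x, m + x.length⟩

/-- The quotient of the integer division by `q ^ m`. -/
def qDivPow (m : ℕ) (x : List ℕ) : Counted (List ℕ) := ⟨x.drop m, x.length⟩

/-- The remainder of the integer division by `q ^ m`, with exactly `m` digits. -/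
def qModPow (m : ℕ) (x : List ℕ) : Counted (List ℕ) :=
  ⟨x.take m ++ List.replicate (m - x.length) 0, m⟩

/-- The same digits with the most significant one first. -/
def qReverse (x : List ℕ) : Counted (List ℕ) := ⟨x.reverse, x.length⟩

/-! ### Loops and the table of partition numbers -/

/-- `for j = start, …, start + count - 1 do body`, the counter `j` being incremented and tested
after each round. -/
def forLoop {σ : Type} (q : ℕ) (body : ℕ → σ → Counted σ) :
    (count start : ℕ) → σ → Counted σ
  | 0, _, s => pure s
  | c + 1, j, s => do
    let s₁ ← body j s
    let j₁ ← idxAdd q j 1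
    let _ ← idxEq q j₁ (j + c + 1)
    forLoop q body c j₁ s₁

/-- A memory whose cell `(j, l, i)` is meant to hold `p(j, l, i)`, the number of partitions of `i`
whose Ferrers diagrams fit into a `j × l` box. -/
abbrev Table := ℕ × ℕ × ℕ → List ℕ

/-- The cost of addressing a cell. -/
def addrCost (q : ℕ) (a : ℕ × ℕ × ℕ) : ℕ :=
  idxLen q a.1 + idxLen q a.2.1 + idxLen q a.2.2 + 1

def readCell (q : ℕ) (T : Table) (a : ℕ × ℕ × ℕ) : Counted (List ℕ) :=
  ⟨T a, addrCost q a + (T a).length⟩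

def writeCell (q : ℕ) (T : Table) (a : ℕ × ℕ × ℕ) (x : List ℕ) : Counted Table :=
  ⟨Function.update T a x, addrCost q a + x.length⟩

/-- Compute `p(j, l, i)` from earlier cells by
`p(j, l, i) = p(j, l - 1, i - j) + p(j - 1, l, i)`, the first term being `0` for `i < j`, with
`p(j, l, 0) = 1` and `p(j, l, i) = 0` for `i > 0`, `j l = 0`. -/
def fillCell (q j l i : ℕ) (T : Table) : Counted Table := do
  if ← idxEq q i 0 then
    writeCell q T (j, l, i) [1]
  else if ← idxEq q j 0 then
    writeCell q T (j, l, i) []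
  else if ← idxEq q l 0 then
    writeCell q T (j, l, i) []
  else do
    let j₁ ← idxSub q j 1
    let y ← readCell q T (j₁, l, i)
    if ← idxLt q i j then
      writeCell q T (j, l, i) y
    else do
      let l₁ ← idxSub q l 1
      let i₁ ← idxSub q i j
      let x ← readCell q T (j, l₁, i₁)
      let s ← qAdd q x y
      writeCell q T (j, l, i) s

/-- The table of `p(j, l, i)` for `j ≤ k`, `l ≤ η` and `i ≤ N`. -/
def buildTable (q k η N : ℕ) : Counted Table :=
  forLoop q (fun j => forLoop q (fun l => forLoop q (fun i => fillCell q j l i)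
    (N + 1) 0) (η + 1) 0) (k + 1) 0 (fun _ => [])

/-! ### Encoding Algorithm B: from an index to a Ferrers diagram of size `m` -/

/-- `N_m(a, 𝓕_{j-1}, …, 𝓕₁) = p(a, η - j, m - S - a)`, where `S = 𝓕₁ + ⋯ + 𝓕_{j-1}`. -/
def lookupN (q η : ℕ) (T : Table) (m j S a : ℕ) : Counted (List ℕ) := do
  let S₁ ← idxAdd q S a
  if ← idxLt q m S₁ then
    pure []
  else do
    let i ← idxSub q m S₁
    let l ← idxSub q η j
    readCell q T (a, l, i)

/-- `while h ≥ N_m(a, 𝓕_{j-1}, …, 𝓕₁)` decrease `h` by this number and `a` by `1`. The result is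
the final `(a, h)`. (For a valid index the test fails at `a = 0` at the latest.) -/
def whileB (q η : ℕ) (T : Table) (m j S : ℕ) : ℕ → List ℕ → Counted (ℕ × List ℕ)
  | 0, h => do
    let v ← lookupN q η T m j S 0
    let _ ← qLess h v
    pure (0, h)
  | a + 1, h => do
    let v ← lookupN q η T m j S (a + 1)
    if ← qLess h v then
      pure (a + 1, h)
    else do
      let h₁ ← qSub q h v
      let _ ← idxSub q (a + 1) 1
      whileB q η T m j S a h₁

/-- Step 2: the columns `𝓕_j, 𝓕_{j+1}, …` (`count` of them), where `a = 𝓕_{j-1}` and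
`S = 𝓕₁ + ⋯ + 𝓕_{j-1}`. -/
def columnsB (q η : ℕ) (T : Table) (m : ℕ) :
    (count j a S : ℕ) → List ℕ → Counted (List ℕ)
  | 0, _, _, _, _ => pure []
  | c + 1, j, a, S, h => do
    let j₁ ← idxAdd q j 1
    let _ ← idxLt q η j₁
    if ← idxEq q S m then
      let b ← idxWrite q 0
      let r ← columnsB q η T m c j₁ b S h
      pure (b :: r)
    else do
      let w ← whileB q η T m j S a h
      let b ← idxWrite q w.1
      let S₁ ← idxAdd q S b
      let r ← columnsB q η T m c j₁ b S₁ w.2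
      pure (b :: r)

/-- Encoding Algorithm B; the output is `[𝓕₁, …, 𝓕_η]`. -/
def algorithmB (q k η : ℕ) (T : Table) (m : ℕ) (h : List ℕ) : Counted (List ℕ) :=
  match η with
  | 0 => pure []
  | c + 1 => do
    let w ← whileB q (c + 1) T m 1 0 k h
    let b ← idxWrite q w.1
    let r ← columnsB q (c + 1) T m c 2 b b w.2
    pure (b :: r)

/-! ### Encoding Algorithm C: from an index to a Ferrers tableaux form -/

/-- The rounds `j, j + 1, …` (`count` of them) of the main loop, where `y` is `i_j` and
`N = k η`. -/
def searchC (q k η N : ℕ) (T : Table) :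
    (count j : ℕ) → List ℕ → Counted (Option (List ℕ × List ℕ))
  | 0, _, _ => pure none
  | c + 1, j, y => do
    let m ← idxSub q N j
    let α ← readCell q T (k, η, m)
    let A ← qShift m α
    if ← qLess y A then
      let h ← qDivPow m y
      let D ← algorithmB q k η T m h
      let r ← qModPow m y
      let x ← qReverse r
      pure (some (D, x))
    else do
      let y₁ ← qSub q y A
      let j₁ ← idxAdd q j 1
      let _ ← idxLt q N j₁
      searchC q k η N T c j₁ y₁

/-- Encoding Algorithm C. The input is an index `i` by its `q`-ary digits; the output is the
Ferrers diagram (column heights, from right to left) and the entries vector. -/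
def algorithmC (q n k : ℕ) (i : List ℕ) : Counted (Option (List ℕ × List ℕ)) := do
  let η ← idxSub q n k
  let N ← idxMul q k η
  let T ← buildTable q k η N
  searchC q k η N T (N + 1) 0 i

end Counted

/-!
A subspace is determined by its tableaux form `(D, x)`, and every pair of a diagram `D` in the box
and a digit string `x` of length `|D|` occurs, because the free entries of a reduced row echelon
form can be prescribed. The forms with `m` dots therefore number `α_m q ^ m`, and the number of
forms that precede `(D, x)` is `∑_{c > m} α_c q ^ c + h q ^ m + {x}`, where `h` is the rank of `D`
among the diagrams with `m` dots. Splitting the partitions in a box by their first column writes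
`h` itself as a sum of the numbers `N(a)` for the heights `a` above the chosen ones. The algorithm
reads off the parts of these sums by successive subtraction, and so inverts the rank.

Put `N = k (n - k)`. At `z = s / (s + 1)` with `s ~ √N` the generating function `∏ (1 - z ^ i)⁻¹`
of the partition numbers yields `p(a, b, m) ≤ exp (O(√N))` for `m ≤ N`, so the table entries have
`O(√N)` digits, and the `O(N ^ 2)` entries cost `O(N ^ (5 / 2))` in total. The rest of the
algorithm costs `O(N ^ 2)`.
-/

namespace Counted

section Monad

variable {α β : Type}

@[simp] theorem val_bind (x : Counted α) (f : α → Counted β) :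
    (x >>= f).val = (f x.val).val := rfl

@[simp] theorem cost_bind (x : Counted α) (f : α → Counted β) :
    (x >>= f).cost = x.cost + (f x.val).cost := rfl

@[simp] theorem val_pure (a : α) : (pure a : Counted α).val = a := rfl

@[simp] theorem cost_pure (a : α) : (pure a : Counted α).cost = 0 := rfl

end Monad

/-! ## Arithmetic on lists of digits -/

/-- `x` consists of base-`q` digits. Leading zeros are allowed, so that `x` need not be of the form
`Nat.digits q a`; this is what subtraction and division by powers of `q` preserve. -/
def IsDigits (q : ℕ) (x : List ℕ) : Prop := ∀ d ∈ x, d < q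

section Digits

variable {q : ℕ} {x y : List ℕ}

theorem isDigits_nil : IsDigits q [] := by simp [IsDigits]

theorem isDigits_cons {a : ℕ} : IsDigits q (a :: x) ↔ a < q ∧ IsDigits q x := by simp [IsDigits]

theorem isDigits_digits (hq : 1 < q) (a : ℕ) : IsDigits q (Nat.digits q a) :=
  fun _ hd => Nat.digits_lt_base hq hd

theorem IsDigits.append (hx : IsDigits q x) (hy : IsDigits q y) : IsDigits q (x ++ y) :=
  List.forall_mem_append.2 ⟨hx, hy⟩

theorem isDigits_replicate_zero (hq : 0 < q) (m : ℕ) : IsDigits q (List.replicate m 0) :=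
  fun _ hd => List.eq_of_mem_replicate hd ▸ hq

theorem length_digits_le_of_le_ofDigits (hq : 1 < q) (hx : IsDigits q x) {a : ℕ}
    (h : a ≤ Nat.ofDigits q x) : (Nat.digits q a).length ≤ x.length :=
  (Nat.digits_length_le_iff hq a).2 (h.trans_lt (Nat.ofDigits_lt_base_pow_length hq hx))

theorem add_length_digits_le_of_mul_pow_le_ofDigits (hq : 1 < q) (hx : IsDigits q x) {a m : ℕ}
    (ha : 0 < a) (h : a * q ^ m ≤ Nat.ofDigits q x) :
    m + (Nat.digits q a).length ≤ x.length := by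
  have hlen := length_digits_le_of_le_ofDigits hq hx h
  rw [mul_comm, Nat.digits_base_pow_mul hq ha] at hlen
  simpa using hlen

end Digits

theorem digits_add_carry {q : ℕ} (hq : 1 < q) {a b c : ℕ} (h : 0 < a + b + c) :
    Nat.digits q (a + b + c) = (a % q + b % q + c) % q ::
      Nat.digits q (a / q + b / q + (a % q + b % q + c) / q) := by
  have hsplit : a + b + c = (a % q + b % q + c) + q * (a / q + b / q) := by
    rw [mul_add]
    linarith [Nat.mod_add_div a q, Nat.mod_add_div b q]
  rw [Nat.digits_def' hq h, hsplit, Nat.add_mul_mod_self_left, Nat.add_mul_div_left _ _ (by lia),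
    add_comm ((_ : ℕ) / q)]

theorem val_qAddCarry_digits_eq_cons {q : ℕ} (hq : 1 < q) {a b c : ℕ} (h : 0 < a + b) :
    (qAddCarry q (Nat.digits q a) (Nat.digits q b) c).val = (a % q + b % q + c) % q ::
      (qAddCarry q (Nat.digits q (a / q)) (Nat.digits q (b / q))
        ((a % q + b % q + c) / q)).val := by
  rcases Nat.eq_zero_or_pos a with rfl | ha <;> rcases Nat.eq_zero_or_pos b with rfl | hb
  · simp at h
  · simp [Nat.digits_def' hq hb, qAddCarry, digitAdd]
  · simp [Nat.digits_def' hq ha, qAddCarry, digitAdd]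
  · simp [Nat.digits_def' hq ha, Nat.digits_def' hq hb, qAddCarry, digitAdd]

theorem val_qAddCarry_digits {q : ℕ} (hq : 1 < q) (a b : ℕ) {c : ℕ} (hc : c ≤ 1) :
    (qAddCarry q (Nat.digits q a) (Nat.digits q b) c).val = Nat.digits q (a + b + c) := by
  induction hs : a + b using Nat.strong_induction_on generalizing a b c with
  | _ s ih =>
  subst hs
  rcases Nat.eq_zero_or_pos (a + b) with h0 | hpos
  · obtain ⟨rfl, rfl⟩ : a = 0 ∧ b = 0 := by lia
    interval_cases c
    · simp [qAddCarry, digitCmp]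
    · simp [qAddCarry, digitCmp, digitWrite, Nat.digits_of_lt q 1 one_ne_zero hq, compare,
        compareOfLessAndEq]
  · have hcarry : (a % q + b % q + c) / q ≤ 1 := by
      have ha := Nat.mod_lt a (by lia : 0 < q)
      have hb := Nat.mod_lt b (by lia : 0 < q)
      exact Nat.le_of_lt_succ ((Nat.div_lt_iff_lt_mul (by lia)).2 (by lia))
    have hdecr : a / q + b / q < a + b := by
      rw [← Nat.mul_lt_mul_left (show 0 < q by lia), mul_add]
      nlinarith [Nat.mul_div_le a q, Nat.mul_div_le b q]
    rw [val_qAddCarry_digits_eq_cons hq hpos, digits_add_carry hq (by lia),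
      ih _ hdecr _ _ hcarry rfl]

theorem val_qAdd_digits {q : ℕ} (hq : 1 < q) (a b : ℕ) :
    (qAdd q (Nat.digits q a) (Nat.digits q b)).val = Nat.digits q (a + b) :=
  val_qAddCarry_digits hq a b zero_le_one

theorem cost_qAddCarry_le (q : ℕ) (x y : List ℕ) (c : ℕ) :
    (qAddCarry q x y c).cost ≤ x.length + y.length + 2 := by
  fun_induction qAddCarry q x y c with
  | case1 c =>
    simp only [cost_bind, digitCmp]
    split <;> simp [digitWrite]
  | case2 a as c ih =>
    have := ih (digitAdd q a 0 c).val
    simp only [cost_bind, cost_pure, digitAdd, List.length_cons] at *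
    lia
  | case3 b bs c ih =>
    have := ih (digitAdd q 0 b c).val
    simp only [cost_bind, cost_pure, digitAdd, List.length_cons] at *
    lia
  | case4 a as b bs c ih =>
    have := ih (digitAdd q a b c).val
    simp only [cost_bind, cost_pure, digitAdd, List.length_cons] at *
    lia

theorem cost_qAdd_le (q : ℕ) (x y : List ℕ) : (qAdd q x y).cost ≤ x.length + y.length + 2 :=
  cost_qAddCarry_le q x y 0

theorem length_val_qSubBorrow (q : ℕ) (x y : List ℕ) (c : ℕ) :
    (qSubBorrow q x y c).val.length = x.length := by
  fun_induction qSubBorrow q x y c with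
  | case1 => simp
  | case2 a as c ih => simp [ih]
  | case3 a as b bs c ih => simp [ih]

theorem cost_qSubBorrow (q : ℕ) (x y : List ℕ) (c : ℕ) :
    (qSubBorrow q x y c).cost = x.length := by
  fun_induction qSubBorrow q x y c with
  | case1 => simp
  | case2 a as c ih => simp [ih, digitSub, add_comm]
  | case3 a as b bs c ih => simp [ih, digitSub, add_comm]

theorem val_digitSub_fst_lt {q a b c : ℕ} (ha : a < q) : (digitSub q a b c).val.1 < q := by
  simp only [digitSub]
  split <;> simp only <;> lia

theorem val_digitSub_snd_le (q a b c : ℕ) : (digitSub q a b c).val.2 ≤ 1 := by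
  simp only [digitSub]
  split <;> simp

theorem val_digitSub_add {q a b c : ℕ} (hb : b < q) (hc : c ≤ 1) :
    (digitSub q a b c).val.1 + b + c = a + q * (digitSub q a b c).val.2 := by
  simp only [digitSub]
  split <;> simp only <;> lia

theorem isDigits_val_qSubBorrow {q : ℕ} {x : List ℕ} (y : List ℕ) (c : ℕ) (hx : IsDigits q x) :
    IsDigits q (qSubBorrow q x y c).val := by
  fun_induction qSubBorrow q x y c with
  | case1 => exact hx
  | case2 a as c ih =>
    rw [isDigits_cons] at hx
    exact isDigits_cons.2 ⟨val_digitSub_fst_lt hx.1, ih _ hx.2⟩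
  | case3 a as b bs c ih =>
    rw [isDigits_cons] at hx
    exact isDigits_cons.2 ⟨val_digitSub_fst_lt hx.1, ih _ hx.2⟩

theorem add_val_digitSub_snd_le {q a b c A B : ℕ} (ha : a < q) (hb : b < q) (hc : c ≤ 1)
    (h : b + q * B + c ≤ a + q * A) : B + (digitSub q a b c).val.2 ≤ A := by
  have hdigit := val_digitSub_add (a := a) hb hc
  have hlt := val_digitSub_fst_lt (b := b) (c := c) ha
  by_contra! hcon
  have := Nat.mul_le_mul_left q (Nat.succ_le_of_lt hcon)
  lia

theorem ofDigits_val_qSubBorrow_add {q : ℕ} {x y : List ℕ} {c : ℕ} (hx : IsDigits q x)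
    (hy : IsDigits q y) (hlen : y.length ≤ x.length) (hc : c ≤ 1)
    (hle : Nat.ofDigits q y + c ≤ Nat.ofDigits q x) :
    Nat.ofDigits q (qSubBorrow q x y c).val + (Nat.ofDigits q y + c) = Nat.ofDigits q x := by
  fun_induction qSubBorrow q x y c with
  | case1 y c =>
    obtain rfl : y = [] := List.length_eq_zero_iff.1 (Nat.le_zero.1 hlen)
    simpa using hle
  | case2 a as c ih =>
    rw [isDigits_cons] at hx
    have hq : 0 < q := by lia
    have hdigit := val_digitSub_add (a := a) hq hc
    have hrest := ih (digitSub q a 0 c).val hx.2 isDigits_nil (by simp)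
      (val_digitSub_snd_le q a 0 c)
      (add_val_digitSub_snd_le hx.1 hq hc (by simpa [Nat.ofDigits_cons] using hle))
    simp only [val_bind, val_pure, Nat.ofDigits_cons, Nat.ofDigits_nil] at *
    rw [← hrest, mul_add]
    lia
  | case3 a as b bs c ih =>
    rw [isDigits_cons] at hx hy
    have hdigit := val_digitSub_add (a := a) hy.1 hc
    have hrest := ih (digitSub q a b c).val hx.2 hy.2 (by simpa using hlen)
      (val_digitSub_snd_le q a b c)
      (add_val_digitSub_snd_le hx.1 hy.1 hc (by simpa [Nat.ofDigits_cons] using hle))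
    simp only [val_bind, val_pure, Nat.ofDigits_cons] at *
    rw [← hrest, mul_add, mul_add]
    lia

theorem updateVerdict_compare_iff {q a b A B : ℕ} (ha : a < q) (hb : b < q) (r : Bool) :
    (A < B ∨ A = B ∧ updateVerdict r (compare a b) = true) ↔
      a + q * A < b + q * B ∨ a + q * A = b + q * B ∧ r = true := by
  rcases lt_trichotomy A B with h | rfl | h
  · have := Nat.mul_le_mul_left q (Nat.succ_le_of_lt h)
    simp only [h, true_or, true_iff]
    left; lia
  · rcases lt_trichotomy a b with h | rfl | h
    · simp [h, Nat.compare_eq_lt.2 h, updateVerdict]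
    · simp [updateVerdict]
    · simp [Nat.compare_eq_gt.2 h, updateVerdict, h.not_gt, h.ne']
  · have := Nat.mul_le_mul_left q (Nat.succ_le_of_lt h)
    constructor <;> intro <;> lia

theorem val_qLessAux_iff {q : ℕ} {x y : List ℕ} (hx : IsDigits q x) (hy : IsDigits q y)
    (r : Bool) : (qLessAux x y r).val = true ↔ Nat.ofDigits q x < Nat.ofDigits q y ∨
      Nat.ofDigits q x = Nat.ofDigits q y ∧ r = true := by
  fun_induction qLessAux x y r with
  | case1 r => simp
  | case2 a as r ih =>
    rw [isDigits_cons] at hx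
    refine (ih _ hx.2 hy).trans ?_
    simpa [Nat.ofDigits_cons, digitCmp] using
      updateVerdict_compare_iff (A := Nat.ofDigits q as) (B := 0) hx.1 (by lia : 0 < q) r
  | case3 b bs r ih =>
    rw [isDigits_cons] at hy
    refine (ih _ hx hy.2).trans ?_
    simpa [Nat.ofDigits_cons, digitCmp] using
      updateVerdict_compare_iff (A := 0) (B := Nat.ofDigits q bs) (by lia : 0 < q) hy.1 r
  | case4 a as b bs r ih =>
    rw [isDigits_cons] at hx hy
    refine (ih _ hx.2 hy.2).trans ?_
    simpa [Nat.ofDigits_cons, digitCmp] using updateVerdict_compare_iff hx.1 hy.1 r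

theorem val_qLess_iff {q : ℕ} {x y : List ℕ} (hx : IsDigits q x) (hy : IsDigits q y) :
    (qLess x y).val = true ↔ Nat.ofDigits q x < Nat.ofDigits q y := by
  simp [qLess, val_qLessAux_iff hx hy]

theorem cost_qLessAux_le (x y : List ℕ) (r : Bool) :
    (qLessAux x y r).cost ≤ x.length + y.length := by
  fun_induction qLessAux x y r with
  | case1 => simp
  | case2 a as r ih =>
    have := ih (compare a 0)
    simp only [cost_bind, digitCmp, List.length_cons, List.length_nil] at *
    lia
  | case3 b bs r ih =>
    have := ih (compare 0 b)
    simp only [cost_bind, digitCmp, List.length_cons, List.length_nil] at *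
    lia
  | case4 a as b bs r ih =>
    have := ih (compare a b)
    simp only [cost_bind, digitCmp, List.length_cons] at *
    lia

theorem cost_qLess_le (x y : List ℕ) : (qLess x y).cost ≤ x.length + y.length :=
  cost_qLessAux_le x y false

theorem ofDigits_val_qShift (q m : ℕ) (x : List ℕ) :
    Nat.ofDigits q (qShift m x).val = Nat.ofDigits q x * q ^ m := by
  simp [qShift, Nat.ofDigits_append, mul_comm]

theorem ofDigits_val_qModPow_add (q m : ℕ) (y : List ℕ) :
    Nat.ofDigits q (qModPow m y).val + Nat.ofDigits q (qDivPow m y).val * q ^ m =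
      Nat.ofDigits q y := by
  simp only [qModPow, qDivPow, Nat.ofDigits_append_replicate_zero]
  rcases Nat.le_total m y.length with h | h
  · conv_rhs => rw [← List.take_append_drop m y, Nat.ofDigits_append, List.length_take,
      min_eq_left h, mul_comm]
  · rw [List.take_of_length_le h, List.drop_of_length_le h]
    simp

end Counted

/-! ## Partitions in a box -/

open Polynomial in
/-- The generating polynomial of the partitions whose diagrams fit into an `a × b` box. The
recursion splits them by whether the box side `a` is attained by a column of the diagram. -/
noncomputable def boxPoly : ℕ → ℕ → Polynomial ℕ
  | 0, _ => 1
  | _ + 1, 0 => 1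
  | a + 1, b + 1 => X ^ (a + 1) * boxPoly (a + 1) b + boxPoly a (b + 1)

/-- The number `p(a, b, m)` of partitions of `m` whose diagrams fit into an `a × b` box. -/
noncomputable def boxCount (a b m : ℕ) : ℕ := (boxPoly a b).coeff m

section BoxCount

@[simp] theorem boxPoly_zero_left (b : ℕ) : boxPoly 0 b = 1 := by simp [boxPoly]

@[simp] theorem boxPoly_zero_right (a : ℕ) : boxPoly a 0 = 1 := by cases a <;> simp [boxPoly]

theorem boxPoly_succ_succ (a b : ℕ) : boxPoly (a + 1) (b + 1) =
    Polynomial.X ^ (a + 1) * boxPoly (a + 1) b + boxPoly a (b + 1) := by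
  rw [boxPoly]

theorem boxCount_succ_succ (a b m : ℕ) : boxCount (a + 1) (b + 1) m =
    (if a + 1 ≤ m then boxCount (a + 1) b (m - (a + 1)) else 0) + boxCount a (b + 1) m := by
  simp only [boxCount, boxPoly_succ_succ, Polynomial.coeff_add, Polynomial.coeff_X_pow_mul']

theorem boxCount_zero_left (b m : ℕ) : boxCount 0 b m = if m = 0 then 1 else 0 := by
  simp [boxCount, Polynomial.coeff_one]

theorem boxCount_zero_right (a m : ℕ) : boxCount a 0 m = if m = 0 then 1 else 0 := by
  simp [boxCount, Polynomial.coeff_one]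

@[simp] theorem boxCount_zero (a b : ℕ) : boxCount a b 0 = 1 := by
  induction a generalizing b with
  | zero => simp [boxCount_zero_left]
  | succ a ih =>
    cases b with
    | zero => simp [boxCount_zero_right]
    | succ b => simp [boxCount_succ_succ, ih]

theorem boxCount_pos {a b m : ℕ} (hm : m ≤ a * b) : 0 < boxCount a b m := by
  induction a generalizing b m with
  | zero =>
    obtain rfl : m = 0 := by lia
    simp
  | succ a iha =>
    induction b generalizing m with
    | zero =>
      obtain rfl : m = 0 := by lia
      simp
    | succ b ihb =>
      rw [boxCount_succ_succ]
      by_cases ham : a + 1 ≤ m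
      · rw [if_pos ham]
        exact Nat.add_pos_left (ihb (by lia)) _
      · refine Nat.add_pos_right _ (iha ?_)
        nlinarith

theorem natDegree_boxPoly_le (a b : ℕ) : (boxPoly a b).natDegree ≤ a * b := by
  induction a generalizing b with
  | zero => simp
  | succ a iha =>
    induction b with
    | zero => simp
    | succ b ihb =>
      rw [boxPoly_succ_succ]
      refine (Polynomial.natDegree_add_le _ _).trans (max_le ?_ ?_)
      · refine Polynomial.natDegree_mul_le.trans ?_
        rw [Polynomial.natDegree_X_pow]
        lia
      · exact (iha _).trans (by lia)

theorem sum_boxCount_mul_pow (a b q : ℕ) :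
    ∑ m ∈ Finset.range (a * b + 1), boxCount a b m * q ^ m = (boxPoly a b).eval q :=
  (Polynomial.eval_eq_sum_range' (Nat.lt_succ_of_le (natDegree_boxPoly_le a b)) q).symm

theorem eval_boxPoly_le {q : ℕ} (hq : 1 < q) (a b : ℕ) :
    (boxPoly a b).eval q ≤ q ^ (a * b + a + b) := by
  induction a generalizing b with
  | zero => simpa using Nat.one_le_pow _ _ (by lia)
  | succ a iha =>
    induction b with
    | zero => simpa using Nat.one_le_pow _ _ (by lia)
    | succ b ihb =>
      set e := (a + 1) * (b + 1) + (a + 1) + b with he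
      have wide : q ^ (a + 1) * (boxPoly (a + 1) b).eval q ≤ q ^ e :=
        (Nat.mul_le_mul_left _ ihb).trans_eq (by rw [← pow_add, he]; ring)
      have narrow : (boxPoly a (b + 1)).eval q ≤ q ^ e :=
        (iha (b + 1)).trans (Nat.pow_le_pow_right (by lia) (by lia))
      calc (boxPoly (a + 1) (b + 1)).eval q
          = q ^ (a + 1) * (boxPoly (a + 1) b).eval q + (boxPoly a (b + 1)).eval q := by
            simp only [boxPoly_succ_succ, Polynomial.eval_add, Polynomial.eval_mul,
              Polynomial.eval_pow, Polynomial.eval_X]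
        _ ≤ q ^ e * q := by nlinarith
        _ = q ^ (e + 1) := (pow_succ _ _).symm

end BoxCount

section GaussCoeff

variable {q : ℕ}

theorem prod_pow_sub_one_ne_zero (hq : 1 < q) (k : ℕ) :
    ∏ i ∈ Finset.range k, ((q : ℚ) ^ (i + 1) - 1) ≠ 0 :=
  Finset.prod_ne_zero_iff.2 fun i _ =>
    sub_ne_zero.2 (one_lt_pow₀ (by exact_mod_cast hq) i.succ_ne_zero).ne'

theorem gaussCoeff_mul_prod (hq : 1 < q) (n k : ℕ) :
    gaussCoeff q n k * ∏ i ∈ Finset.range k, ((q : ℚ) ^ (i + 1) - 1) =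
      ∏ i ∈ Finset.range k, ((q : ℚ) ^ (n - i) - 1) := by
  have reflect : ∏ i ∈ Finset.range k, ((q : ℚ) ^ (k - i) - 1) =
      ∏ i ∈ Finset.range k, ((q : ℚ) ^ (i + 1) - 1) := by
    rw [← Finset.prod_range_reflect]
    refine Finset.prod_congr rfl fun i hi => ?_
    have := Finset.mem_range.1 hi
    congr 2
    lia
  rw [gaussCoeff, Finset.prod_div_distrib, reflect,
    div_mul_cancel₀ _ (prod_pow_sub_one_ne_zero hq k)]

theorem eval_boxPoly_mul_prod (q a b : ℕ) :
    (((boxPoly a b).eval q : ℕ) : ℚ) * ∏ i ∈ Finset.range a, ((q : ℚ) ^ (i + 1) - 1) =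
      ∏ i ∈ Finset.range a, ((q : ℚ) ^ (b + 1 + i) - 1) := by
  induction a generalizing b with
  | zero => simp
  | succ a iha =>
    induction b with
    | zero => simp [add_comm 1]
    | succ b ihb =>
      rw [boxPoly_succ_succ, Polynomial.eval_add, Polynomial.eval_mul, Polynomial.eval_pow,
        Polynomial.eval_X]
      push_cast
      rw [add_mul, mul_assoc, ihb, Finset.prod_range_succ (fun i => (q : ℚ) ^ (i + 1) - 1),
        ← mul_assoc, iha, Finset.prod_range_succ' (fun i => (q : ℚ) ^ (b + 1 + i) - 1),
        Finset.prod_range_succ (fun i => (q : ℚ) ^ (b + 1 + 1 + i) - 1)]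
      rw [Finset.prod_congr rfl fun i _ => by rw [show b + 1 + (i + 1) = b + 1 + 1 + i by ring]]
      ring

theorem eval_boxPoly_eq_gaussCoeff (hq : 1 < q) {n k : ℕ} (hk : k ≤ n) :
    (((boxPoly k (n - k)).eval q : ℕ) : ℚ) = gaussCoeff q n k := by
  refine mul_right_cancel₀ (prod_pow_sub_one_ne_zero hq k) ?_
  rw [gaussCoeff_mul_prod hq, eval_boxPoly_mul_prod, ← Finset.prod_range_reflect]
  refine Finset.prod_congr rfl fun i hi => ?_
  have := Finset.mem_range.1 hi
  congr 2
  lia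

end GaussCoeff

section Subexponential

theorem boxCount_mul_pow_le_prod {x : ℝ} (hx0 : 0 ≤ x) (hx1 : x < 1) (a b m : ℕ) :
    (boxCount a b m : ℝ) * x ^ m ≤ ∏ i ∈ Finset.range a, (1 - x ^ (i + 1))⁻¹ := by
  have hpos (i : ℕ) : 0 < 1 - x ^ (i + 1) := sub_pos.2 (pow_lt_one₀ hx0 hx1 i.succ_ne_zero)
  have hone (a : ℕ) : 1 ≤ ∏ i ∈ Finset.range a, (1 - x ^ (i + 1))⁻¹ :=
    Finset.one_le_prod fun i _ => (one_le_inv₀ (hpos i)).2 (sub_le_self _ (by positivity))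
  induction a generalizing b m with
  | zero =>
    rw [boxCount_zero_left]
    split <;> simp [*]
  | succ a iha =>
    induction b generalizing m with
    | zero =>
      rw [boxCount_zero_right]
      split
      · simpa [*] using hone (a + 1)
      · simpa using zero_le_one.trans (hone (a + 1))
    | succ b ihb =>
      have wide : ((if a + 1 ≤ m then boxCount (a + 1) b (m - (a + 1)) else 0 : ℕ) : ℝ) * x ^ m ≤
          x ^ (a + 1) * ∏ i ∈ Finset.range (a + 1), (1 - x ^ (i + 1))⁻¹ := by
        split_ifs with ham
        · calc (boxCount (a + 1) b (m - (a + 1)) : ℝ) * x ^ m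
              = x ^ (a + 1) * (boxCount (a + 1) b (m - (a + 1)) * x ^ (m - (a + 1))) := by
                rw [mul_left_comm, ← pow_add, Nat.add_sub_cancel' ham]
            _ ≤ _ := mul_le_mul_of_nonneg_left (ihb _) (by positivity)
        · have := hone (a + 1)
          simp only [Nat.cast_zero, zero_mul]
          positivity
      rw [boxCount_succ_succ, Nat.cast_add, add_mul]
      refine (add_le_add wide (iha (b + 1) m)).trans_eq ?_
      rw [Finset.prod_range_succ]
      have := (hpos a).ne'
      field_simp
      ring

variable {s : ℕ}

theorem div_add_one_pow_le (hs : 0 < s) (n : ℕ) :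
    ((s : ℝ) / (s + 1)) ^ n ≤ s / (s + n) := by
  have bernoulli : 1 + n * (1 / (s : ℝ)) ≤ (1 + 1 / (s : ℝ)) ^ n :=
    one_add_mul_le_pow ((neg_nonpos.2 zero_le_two).trans (by positivity)) n
  calc ((s : ℝ) / (s + 1)) ^ n = ((1 + 1 / (s : ℝ)) ^ n)⁻¹ := by
        rw [← inv_pow]
        congr 1
        field_simp
    _ ≤ (1 + n * (1 / (s : ℝ)))⁻¹ := inv_anti₀ (by positivity) bernoulli
    _ = s / (s + n) := by field_simp

theorem prod_add_div_eq_choose (s t : ℕ) :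
    ∏ i ∈ Finset.range t, ((s : ℝ) + (i + 1)) / (i + 1) = (s + t).choose t := by
  induction t with
  | zero => simp
  | succ t ih =>
    have h : ((s : ℝ) + t + 1) * (s + t).choose t = (s + t + 1).choose (t + 1) * (t + 1) := by
      exact_mod_cast Nat.add_one_mul_choose_eq (s + t) t
    rw [Finset.prod_range_succ, ih, ← add_assoc s t 1]
    field_simp
    linarith

theorem inv_one_sub_le_exp {y : ℝ} (hy0 : 0 ≤ y) (hy : y ≤ 1 / 2) :
    (1 - y)⁻¹ ≤ Real.exp (2 * y) := by
  refine le_trans ?_ (Real.add_one_le_exp (2 * y))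
  rw [inv_le_iff_one_le_mul₀ (by linarith)]
  nlinarith

theorem prod_inv_one_sub_pow_le_four_pow (hs : 0 < s) :
    ∏ i ∈ Finset.range s, (1 - ((s : ℝ) / (s + 1)) ^ (i + 1))⁻¹ ≤ 4 ^ s := by
  have factor_le (i : ℕ) : (s : ℝ) / (s + (i + 1)) < 1 ∧
      (1 - ((s : ℝ) / (s + 1)) ^ (i + 1))⁻¹ ≤ ((s : ℝ) + (i + 1)) / (i + 1) := by
    have lt_one : (s : ℝ) / (s + (i + 1)) < 1 := by
      rw [div_lt_one (by positivity)]
      linarith [(Nat.cast_nonneg i : (0 : ℝ) ≤ i)]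
    refine ⟨lt_one, ?_⟩
    have pow_le := div_add_one_pow_le hs (i + 1)
    push_cast at pow_le
    calc (1 - ((s : ℝ) / (s + 1)) ^ (i + 1))⁻¹ ≤ (1 - (s : ℝ) / (s + (i + 1)))⁻¹ :=
          inv_anti₀ (sub_pos.2 lt_one) (by linarith)
      _ = ((s : ℝ) + (i + 1)) / (i + 1) := by
          rw [one_sub_div (by positivity), inv_div, add_sub_cancel_left]
  calc ∏ i ∈ Finset.range s, (1 - ((s : ℝ) / (s + 1)) ^ (i + 1))⁻¹
      ≤ ∏ i ∈ Finset.range s, ((s : ℝ) + (i + 1)) / (i + 1) := by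
        refine Finset.prod_le_prod (fun i _ => inv_nonneg.2 (sub_nonneg.2 ?_)) fun i _ =>
          (factor_le i).2
        exact pow_le_one₀ (by positivity) ((div_le_one (by positivity)).2 (by linarith))
    _ = (s + s).choose s := prod_add_div_eq_choose s s
    _ ≤ 4 ^ s := by
        have := Nat.choose_le_two_pow (s + s) s
        rw [← two_mul, pow_mul] at this
        rw [← two_mul]
        exact_mod_cast this

theorem prod_inv_one_sub_pow_add_le_exp (hs : 0 < s) (a : ℕ) :
    ∏ i ∈ Finset.range a, (1 - ((s : ℝ) / (s + 1)) ^ (s + i + 1))⁻¹ ≤ Real.exp (2 * (s + 1)) := by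
  set x : ℝ := (s : ℝ) / (s + 1) with hx
  have hx0 : 0 ≤ x := by positivity
  have hx1 : x < 1 := (div_lt_one (by positivity)).2 (by linarith)
  have pow_le_half (i : ℕ) : x ^ (s + i + 1) ≤ 1 / 2 := by
    refine (div_add_one_pow_le hs _).trans ?_
    rw [div_le_div_iff₀ (by positivity) two_pos]
    push_cast
    linarith [(Nat.cast_nonneg i : (0 : ℝ) ≤ i)]
  have geom_sum_le : ∑ i ∈ Finset.range a, x ^ i ≤ s + 1 :=
    calc ∑ i ∈ Finset.range a, x ^ i ≤ ∑' i, x ^ i :=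
          (summable_geometric_of_lt_one hx0 hx1).sum_le_tsum _ fun i _ => pow_nonneg hx0 i
      _ = s + 1 := by
          rw [tsum_geometric_of_lt_one hx0 hx1, hx, one_sub_div (by positivity), inv_div]
          simp
  calc ∏ i ∈ Finset.range a, (1 - x ^ (s + i + 1))⁻¹
      ≤ ∏ i ∈ Finset.range a, Real.exp (2 * x ^ i) := by
        refine Finset.prod_le_prod (fun i _ => inv_nonneg.2 (by linarith [pow_le_half i]))
          fun i _ => ?_
        refine (inv_one_sub_le_exp (by positivity) (pow_le_half i)).trans (Real.exp_le_exp.2 ?_)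
        linarith [pow_le_pow_of_le_one hx0 hx1.le (show i ≤ s + i + 1 by lia)]
    _ = Real.exp (2 * ∑ i ∈ Finset.range a, x ^ i) := by rw [← Real.exp_sum, Finset.mul_sum]
    _ ≤ Real.exp (2 * (s + 1)) := by gcongr

theorem exp_neg_le_div_add_one_pow (hs : 0 < s) {m : ℕ} (hm : m ≤ s * s) :
    Real.exp (-s) ≤ ((s : ℝ) / (s + 1)) ^ m := by
  have exp_le : Real.exp (-(1 / s)) ≤ (s : ℝ) / (s + 1) := by
    rw [Real.exp_neg, inv_le_comm₀ (Real.exp_pos _) (by positivity), inv_div]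
    refine le_trans (le_of_eq ?_) (Real.add_one_le_exp (1 / (s : ℝ)))
    field_simp
    ring
  calc Real.exp (-s) ≤ Real.exp (m * -(1 / s)) := by
        refine Real.exp_le_exp.2 ?_
        have : (m : ℝ) * (1 / s) ≤ s := by
          rw [mul_one_div, div_le_iff₀ (by positivity)]
          exact_mod_cast hm
        linarith
    _ = Real.exp (-(1 / s)) ^ m := by rw [Real.exp_nat_mul]
    _ ≤ _ := by gcongr

theorem boxCount_le_four_pow_mul_exp (hs : 0 < s) (a b : ℕ) {m : ℕ} (hm : m ≤ s * s) :
    (boxCount a b m : ℝ) ≤ 4 ^ s * Real.exp (3 * s + 2) := by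
  set x : ℝ := (s : ℝ) / (s + 1)
  have hx0 : 0 ≤ x := by positivity
  have hx1 : x < 1 := (div_lt_one (by positivity)).2 (by linarith)
  have hone (i : ℕ) : 1 ≤ (1 - x ^ (i + 1))⁻¹ :=
    (one_le_inv₀ (sub_pos.2 (pow_lt_one₀ hx0 hx1 i.succ_ne_zero))).2
      (sub_le_self _ (by positivity))
  have hnonneg (i : ℕ) : 0 ≤ (1 - x ^ (i + 1))⁻¹ := zero_le_one.trans (hone i)
  have weighted : (boxCount a b m : ℝ) * x ^ m ≤ 4 ^ s * Real.exp (2 * (s + 1)) :=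
    calc (boxCount a b m : ℝ) * x ^ m
        ≤ ∏ i ∈ Finset.range a, (1 - x ^ (i + 1))⁻¹ := boxCount_mul_pow_le_prod hx0 hx1 a b m
      _ ≤ ∏ i ∈ Finset.range (s + a), (1 - x ^ (i + 1))⁻¹ :=
          Finset.prod_le_prod_of_subset_of_one_le (Finset.range_mono (by lia))
            (fun i _ => hnonneg i) fun i _ _ => hone i
      _ ≤ 4 ^ s * Real.exp (2 * (s + 1)) := by
          rw [Finset.prod_range_add]
          exact mul_le_mul (prod_inv_one_sub_pow_le_four_pow hs)
            (prod_inv_one_sub_pow_add_le_exp hs a) (Finset.prod_nonneg fun i _ => hnonneg _)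
            (by positivity)
  calc (boxCount a b m : ℝ)
      = boxCount a b m * Real.exp (-s) * Real.exp s := by
        rw [mul_assoc, ← Real.exp_add, neg_add_cancel, Real.exp_zero, mul_one]
    _ ≤ boxCount a b m * x ^ m * Real.exp s := by
        gcongr
        exact exp_neg_le_div_add_one_pow hs hm
    _ ≤ 4 ^ s * Real.exp (2 * (s + 1)) * Real.exp s := by gcongr
    _ = 4 ^ s * Real.exp (3 * s + 2) := by
        rw [mul_assoc, ← Real.exp_add]
        ring_nf

theorem boxCount_le_two_pow (hs : 0 < s) (a b : ℕ) {m : ℕ} (hm : m ≤ s * s) :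
    boxCount a b m ≤ 2 ^ (8 * s + 4) := by
  have exp_le : Real.exp (3 * s + 2) ≤ 4 ^ (3 * s + 2) :=
    calc Real.exp (3 * s + 2) = Real.exp 1 ^ (3 * s + 2) := by
          rw [← Real.exp_nat_mul]
          push_cast
          ring_nf
      _ ≤ 4 ^ (3 * s + 2) := by
          gcongr
          linarith [Real.exp_one_lt_d9]
  have : (boxCount a b m : ℝ) ≤ 2 ^ (8 * s + 4) :=
    calc (boxCount a b m : ℝ) ≤ 4 ^ s * Real.exp (3 * s + 2) :=
          boxCount_le_four_pow_mul_exp hs a b hm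
      _ ≤ 4 ^ s * 4 ^ (3 * s + 2) := by gcongr
      _ = 2 ^ (8 * s + 4) := by
          rw [show (4 : ℝ) = 2 ^ 2 by norm_num, ← pow_mul, ← pow_mul, ← pow_add]
          ring_nf
  exact_mod_cast this

end Subexponential

/-! ## The rank of a Ferrers tableaux form -/

/-- `D` lists the column heights of a Ferrers diagram, from right to left, none of them exceeding
`a`. Bounding the first column by a parameter makes the notion hereditary in the list. -/
def IsDiagram (a : ℕ) (D : List ℕ) : Prop := (a :: D).IsChain (· ≥ ·)

/-- The number of diagrams with `M` dots and `b + 1` columns the first of which has height `c`;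
this is the number `N(c)` of Encoding Algorithm B. -/
noncomputable def colCount (b M c : ℕ) : ℕ := if c ≤ M then boxCount c b (M - c) else 0

/-- The number of diagrams with column heights at most `a` that precede `D` among those of the
same size and with the same number of columns: they are sorted by the first column in which they
differ from `D`. -/
noncomputable def diagRank : ℕ → List ℕ → ℕ
  | _, [] => 0
  | a, d :: D => ∑ c ∈ Finset.Ioc d a, colCount D.length (d + D.sum) c + diagRank d D

/-- `(D, x)` has the shape of a Ferrers tableaux form in a `k × η` box. -/
structure IsForm (q k η : ℕ) (D x : List ℕ) : Prop where
  length_diagram : D.length = η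
  isDiagram : IsDiagram k D
  length_entries : x.length = D.sum
  isDigits : Counted.IsDigits q x

/-- The number of tableaux forms in a `k × η` box with at least `c` dots. -/
noncomputable def largeCount (q k η c : ℕ) : ℕ :=
  ∑ m ∈ Finset.Ico c (k * η + 1), boxCount k η m * q ^ m

/-- The number of tableaux forms in a `k × η` box that precede `(D, x)` in the order
`TableauxLT`. -/
noncomputable def formRank (q k η : ℕ) (D x : List ℕ) : ℕ :=
  largeCount q k η (D.sum + 1) + (diagRank k D * q ^ D.sum + vecValue q x)

theorem isDiagram_nil (a : ℕ) : IsDiagram a [] := List.isChain_singleton _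

theorem isDiagram_cons {a d : ℕ} {D : List ℕ} :
    IsDiagram a (d :: D) ↔ d ≤ a ∧ IsDiagram d D := List.isChain_cons_cons

theorem IsDiagram.sum_le {a : ℕ} {D : List ℕ} (hD : IsDiagram a D) : D.sum ≤ D.length * a :=
  List.sum_le_card_nsmul D a fun _ => List.rel_of_pairwise_cons hD.pairwise

section DiagRank

theorem boxCount_succ_eq_colCount_add (a b M : ℕ) :
    boxCount (a + 1) (b + 1) M = colCount b M (a + 1) + boxCount a (b + 1) M :=
  boxCount_succ_succ a b M

theorem boxCount_zero_eq_colCount (b M : ℕ) : boxCount 0 (b + 1) M = colCount b M 0 := by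
  simp [colCount, boxCount_zero_left]

theorem colCount_le_boxCount (b M c : ℕ) : colCount b M c ≤ boxCount c (b + 1) M := by
  cases c with
  | zero => rw [boxCount_zero_eq_colCount]
  | succ c => exact (boxCount_succ_eq_colCount_add c b M).ge.trans' (Nat.le_add_right _ _)

theorem colCount_add_left (b S c : ℕ) : colCount b (c + S) c = boxCount c b S := by
  simp [colCount]

theorem sum_colCount_add_boxCount (b M : ℕ) {d a : ℕ} (hda : d ≤ a) :
    ∑ c ∈ Finset.Ioc d a, colCount b M c + boxCount d (b + 1) M = boxCount a (b + 1) M := by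
  induction a, hda using Nat.le_induction with
  | base => simp
  | succ a hda ih =>
    rw [Finset.sum_Ioc_succ_top (by lia), boxCount_succ_eq_colCount_add]
    lia

theorem IsDiagram.diagRank_lt_boxCount {a : ℕ} {D : List ℕ} (hD : IsDiagram a D) :
    diagRank a D < boxCount a D.length D.sum := by
  induction D generalizing a with
  | nil => simp [diagRank]
  | cons d D ih =>
    obtain ⟨hda, hD⟩ := isDiagram_cons.1 hD
    calc diagRank a (d :: D)
        = ∑ c ∈ Finset.Ioc d a, colCount D.length (d + D.sum) c + diagRank d D := rfl
      _ < ∑ c ∈ Finset.Ioc d a, colCount D.length (d + D.sum) c + boxCount d D.length D.sum :=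
          Nat.add_lt_add_left (ih hD) _
      _ ≤ ∑ c ∈ Finset.Ioc d a, colCount D.length (d + D.sum) c +
            boxCount d (D.length + 1) (d + D.sum) := by
          rw [← colCount_add_left]
          exact Nat.add_le_add_left (colCount_le_boxCount _ _ _) _
      _ = boxCount a (d :: D).length (d :: D).sum := by
          rw [sum_colCount_add_boxCount _ _ hda, List.length_cons, List.sum_cons]

theorem IsDiagram.diagRank_lt_of_lex {a : ℕ} {D D' : List ℕ} (hD : IsDiagram a D)
    (hlen : D.length = D'.length) (hsum : D.sum = D'.sum)
    (hlex : List.Lex (fun a b => b < a) D D') : diagRank a D < diagRank a D' := by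
  induction hlex generalizing a with
  | nil => simp at hlen
  | @cons d D D' _ ih =>
    have hlen' : D.length = D'.length := by simpa using hlen
    have hsum' : D.sum = D'.sum := by simpa using hsum
    simpa only [diagRank, hlen', hsum', add_lt_add_iff_left] using
      ih (isDiagram_cons.1 hD).2 hlen' hsum'
  | @rel d D d' D' hd =>
    obtain ⟨hda, hD⟩ := isDiagram_cons.1 hD
    have hlen' : D.length = D'.length := by simpa using hlen
    have hsum' : d + D.sum = d' + D'.sum := by simpa using hsum
    set f := colCount D.length (d + D.sum)
    calc diagRank a (d :: D) = ∑ c ∈ Finset.Ioc d a, f c + diagRank d D := rfl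
      _ < ∑ c ∈ Finset.Ioc d a, f c + f d := by
          rw [add_lt_add_iff_left, show f d = _ from colCount_add_left _ _ _]
          exact hD.diagRank_lt_boxCount
      _ = ∑ c ∈ insert d (Finset.Ioc d a), f c := by
          rw [Finset.sum_insert Finset.left_notMem_Ioc, add_comm]
      _ ≤ ∑ c ∈ Finset.Ioc d' a, f c := by
          refine Finset.sum_le_sum_of_subset fun c hc => ?_
          simp only [Finset.mem_insert, Finset.mem_Ioc] at hc ⊢
          lia
      _ ≤ diagRank a (d' :: D') := by
          simp only [diagRank, ← hlen', ← hsum']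
          exact Nat.le_add_right _ _

end DiagRank

section LargeCount

variable (q k η : ℕ)

theorem largeCount_eq_add {c : ℕ} (hc : c ≤ k * η) :
    largeCount q k η c = boxCount k η c * q ^ c + largeCount q k η (c + 1) :=
  Finset.sum_eq_sum_Ico_succ_bot (by lia) _

theorem largeCount_anti {c d : ℕ} (hcd : c ≤ d) : largeCount q k η d ≤ largeCount q k η c :=
  Finset.sum_le_sum_of_subset (Finset.Ico_subset_Ico_left hcd)

theorem largeCount_top : largeCount q k η (k * η + 1) = 0 := by simp [largeCount]

end LargeCount

namespace IsForm

variable {q k η : ℕ} {D x D' x' : List ℕ}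

theorem sum_le (h : IsForm q k η D x) : D.sum ≤ k * η := by
  rw [← h.length_diagram, mul_comm]
  exact h.isDiagram.sum_le

theorem vecValue_lt (h : IsForm q k η D x) (hq : 1 < q) : vecValue q x < q ^ D.sum := by
  rw [← h.length_entries, ← List.length_reverse]
  exact Nat.ofDigits_lt_base_pow_length hq fun d hd => h.isDigits d (List.mem_reverse.1 hd)

theorem vecValue_injOn (hq : 1 < q) (h : IsForm q k η D x) (h' : IsForm q k η D x')
    (hv : vecValue q x = vecValue q x') : x = x' :=
  List.reverse_injective <| Nat.ofDigits_inj_of_len_eq hq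
    (by rw [List.length_reverse, List.length_reverse, h.length_entries, h'.length_entries])
    (fun d hd => h.isDigits d (List.mem_reverse.1 hd))
    (fun d hd => h'.isDigits d (List.mem_reverse.1 hd)) hv

theorem diagRank_mul_pow_add_vecValue_lt (h : IsForm q k η D x) (hq : 1 < q) :
    diagRank k D * q ^ D.sum + vecValue q x < boxCount k η D.sum * q ^ D.sum :=
  calc diagRank k D * q ^ D.sum + vecValue q x < (diagRank k D + 1) * q ^ D.sum := by
        rw [add_one_mul]
        exact Nat.add_lt_add_left (h.vecValue_lt hq) _
    _ ≤ boxCount k η D.sum * q ^ D.sum := by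
        rw [← h.length_diagram]
        exact Nat.mul_le_mul_right _ h.isDiagram.diagRank_lt_boxCount

theorem formRank_lt_of_tableauxLT (hq : 1 < q) (h : IsForm q k η D x) (h' : IsForm q k η D' x')
    (hlt : TableauxLT q D x D' x') : formRank q k η D x < formRank q k η D' x' := by
  rcases hlt with hsum | ⟨hsum, hlex⟩ | ⟨rfl, hvalue⟩
  · calc formRank q k η D x
        < largeCount q k η (D.sum + 1) + boxCount k η D.sum * q ^ D.sum :=
          Nat.add_lt_add_left (h.diagRank_mul_pow_add_vecValue_lt hq) _
      _ = largeCount q k η D.sum := by rw [largeCount_eq_add q k η h.sum_le, add_comm]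
      _ ≤ largeCount q k η (D'.sum + 1) := largeCount_anti q k η hsum
      _ ≤ formRank q k η D' x' := Nat.le_add_right _ _
  · have hrank : diagRank k D + 1 ≤ diagRank k D' := h.isDiagram.diagRank_lt_of_lex
      (h.length_diagram.trans h'.length_diagram.symm) hsum hlex
    calc formRank q k η D x
        < largeCount q k η (D.sum + 1) + (diagRank k D * q ^ D.sum + q ^ D.sum) := by
          rw [formRank]
          gcongr
          exact h.vecValue_lt hq
      _ ≤ largeCount q k η (D'.sum + 1) + diagRank k D' * q ^ D'.sum := by
          rw [← add_one_mul, ← hsum]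
          gcongr
      _ ≤ formRank q k η D' x' := by
          rw [formRank]
          lia
  · rw [formRank, formRank]
    gcongr

theorem tableauxLT_trichotomy (hq : 1 < q) (h : IsForm q k η D x) (h' : IsForm q k η D' x') :
    TableauxLT q D x D' x' ∨ (D = D' ∧ x = x') ∨ TableauxLT q D' x' D x := by
  rcases lt_trichotomy D.sum D'.sum with hsum | hsum | hsum
  · exact .inr (.inr (.inl hsum))
  · rcases trichotomous_of (List.Lex fun a b : ℕ => b < a) D D' with hlex | rfl | hlex
    · exact .inl (.inr (.inl ⟨hsum, hlex⟩))
    · rcases lt_trichotomy (vecValue q x) (vecValue q x') with hvalue | hvalue | hvalue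
      · exact .inl (.inr (.inr ⟨rfl, hvalue⟩))
      · exact .inr (.inl ⟨rfl, h.vecValue_injOn hq h' hvalue⟩)
      · exact .inr (.inr (.inr (.inr ⟨rfl, hvalue⟩)))
    · exact .inr (.inr (.inr (.inl ⟨hsum.symm, hlex⟩)))
  · exact .inl (.inl hsum)

theorem tableauxLT_iff_formRank_lt (hq : 1 < q) (h : IsForm q k η D x)
    (h' : IsForm q k η D' x') :
    TableauxLT q D x D' x' ↔ formRank q k η D x < formRank q k η D' x' := by
  refine ⟨h.formRank_lt_of_tableauxLT hq h', fun hlt => ?_⟩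
  rcases h.tableauxLT_trichotomy hq h' with hform | ⟨rfl, rfl⟩ | hform
  · exact hform
  · exact absurd hlt (lt_irrefl _)
  · exact absurd hlt (h'.formRank_lt_of_tableauxLT hq h hform).not_gt

theorem formRank_injOn (hq : 1 < q) (h : IsForm q k η D x) (h' : IsForm q k η D' x')
    (hrank : formRank q k η D x = formRank q k η D' x') : D = D' ∧ x = x' := by
  rcases h.tableauxLT_trichotomy hq h' with hform | heq | hform
  · exact absurd hrank (h.formRank_lt_of_tableauxLT hq h' hform).ne
  · exact heq
  · exact absurd hrank (h'.formRank_lt_of_tableauxLT hq h hform).ne'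

end IsForm

/-! ## Reduced row echelon forms and Ferrers diagrams -/

section Columns

variable {n k : ℕ} {piv : Fin k → Fin n}

theorem mem_freeColumns {c : Fin n} : c ∈ freeColumns piv ↔ ∀ r, piv r ≠ c := by
  simp [freeColumns]

theorem mem_rowsBefore {c : Fin n} {r : Fin k} : r ∈ rowsBefore piv c ↔ piv r < c := by
  simp [rowsBefore]

theorem pairwise_freeColumns (piv : Fin k → Fin n) : (freeColumns piv).Pairwise (· > ·) :=
  (List.pairwise_reverse.2 (List.pairwise_lt_finRange n)).filter _

theorem nodup_freeColumns (piv : Fin k → Fin n) : (freeColumns piv).Nodup :=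
  (pairwise_freeColumns piv).imp ne_of_gt

theorem nodup_rowsBefore (piv : Fin k → Fin n) (c : Fin n) : (rowsBefore piv c).Nodup :=
  (List.nodup_finRange k).filter _

theorem length_freeColumns (hpiv : StrictMono piv) : (freeColumns piv).length = n - k := by
  have hset : (freeColumns piv).toFinset = (Finset.univ.image piv)ᶜ := by
    ext
    simp [mem_freeColumns]
  rw [← List.toFinset_card_of_nodup (nodup_freeColumns piv), hset, Finset.card_compl,
    Finset.card_image_of_injective _ hpiv.injective, Finset.card_univ, Fintype.card_fin,
    Fintype.card_fin]

theorem freeColumns_injOn {piv' : Fin k → Fin n} (hpiv : StrictMono piv)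
    (hpiv' : StrictMono piv') (h : freeColumns piv = freeColumns piv') : piv = piv' := by
  refine (StrictMono.range_inj hpiv hpiv').1 (Set.ext fun c => not_iff_not.1 ?_)
  simpa [mem_freeColumns] using congrArg (c ∈ ·) h

theorem exists_freeColumns_eq (hk : k ≤ n) {L : List (Fin n)} (hL : L.Pairwise (· > ·))
    (hlen : L.length = n - k) : ∃ piv : Fin k → Fin n, StrictMono piv ∧ freeColumns piv = L := by
  have hcard : L.toFinsetᶜ.card = k := by
    rw [Finset.card_compl, List.toFinset_card_of_nodup (hL.imp ne_of_gt), hlen, Fintype.card_fin]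
    lia
  refine ⟨L.toFinsetᶜ.orderEmbOfFin hcard, (L.toFinsetᶜ.orderEmbOfFin hcard).strictMono,
    (pairwise_freeColumns _).eq_of_mem_iff hL fun c => ?_⟩
  have hrange : c ∈ Set.range (L.toFinsetᶜ.orderEmbOfFin hcard) ↔ c ∉ L := by
    rw [Finset.range_orderEmbOfFin]
    simp
  rw [mem_freeColumns, ← not_exists, ← not_iff_not, not_not]
  exact hrange

theorem length_rowsBefore_add_length (hpiv : StrictMono piv) {L : List (Fin n)} (hL : L.Nodup)
    {c : Fin n} (hmem : ∀ a, a ∈ L ↔ a < c ∧ ∀ r, piv r ≠ a) :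
    (rowsBefore piv c).length + L.length = c := by
  have hnodup : ((rowsBefore piv c).map piv ++ L).Nodup := by
    refine ((nodup_rowsBefore piv c).map hpiv.injective).append hL fun a ha haL => ?_
    obtain ⟨r, _, rfl⟩ := List.mem_map.1 ha
    exact ((hmem _).1 haL).2 r rfl
  have hset : ((rowsBefore piv c).map piv ++ L).toFinset = Finset.Iio c := by
    ext a
    simp only [List.mem_toFinset, List.mem_append, List.mem_map, mem_rowsBefore, hmem,
      Finset.mem_Iio]
    grind
  have hcard := List.toFinset_card_of_nodup hnodup
  rw [hset, Fin.card_Iio] at hcard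
  simpa using hcard.symm

theorem mem_tail_freeColumns {c : Fin n} {L : List (Fin n)} (h : c :: L <:+ freeColumns piv)
    (a : Fin n) : a ∈ L ↔ a < c ∧ ∀ r, piv r ≠ a := by
  obtain ⟨P, hP⟩ := h
  have hsorted := pairwise_freeColumns piv
  rw [← hP, List.pairwise_append, List.pairwise_cons] at hsorted
  obtain ⟨-, ⟨hcL, -⟩, hPc⟩ := hsorted
  rw [← mem_freeColumns, ← hP, List.mem_append, List.mem_cons]
  refine ⟨fun ha => ⟨hcL a ha, .inr (.inr ha)⟩, ?_⟩
  rintro ⟨hac, haP | rfl | haL⟩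
  · exact absurd hac (hPc a haP c List.mem_cons_self).not_gt
  · exact absurd hac (lt_irrefl _)
  · exact haL

/-- The positions of the columns without a leading coefficient, from right to left, in terms of the
column heights of the diagram: column `c` has `d` pivots and the remaining free columns to its
left. -/
def columnPositions : List ℕ → List ℕ
  | [] => []
  | d :: D => (d + D.length) :: columnPositions D

theorem length_columnPositions (D : List ℕ) : (columnPositions D).length = D.length := by
  induction D with
  | nil => rfl
  | cons d D ih => simp [columnPositions, ih]

theorem columnPositions_injective : Function.Injective columnPositions := by
  intro D D' h
  induction D generalizing D' with
  | nil => cases D' <;> simp_all [columnPositions]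
  | cons d D ih =>
    cases D' with
    | nil => simp [columnPositions] at h
    | cons d' D' =>
      obtain ⟨hhead, htail⟩ := List.cons.inj h
      obtain rfl := ih htail
      simpa using hhead

theorem IsDiagram.columnPositions_lt {a : ℕ} {D : List ℕ} (hD : IsDiagram a D) {c : ℕ}
    (hc : c ∈ columnPositions D) : c < a + D.length := by
  induction D generalizing a with
  | nil => simp [columnPositions] at hc
  | cons d D ih =>
    obtain ⟨hda, hD⟩ := isDiagram_cons.1 hD
    rw [List.length_cons]
    rcases List.mem_cons.1 hc with rfl | hc
    · lia
    · have := ih hD hc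
      lia

theorem IsDiagram.pairwise_columnPositions {a : ℕ} {D : List ℕ} (hD : IsDiagram a D) :
    (columnPositions D).Pairwise (· > ·) := by
  induction D generalizing a with
  | nil => exact .nil
  | cons d D ih =>
    obtain ⟨-, hD⟩ := isDiagram_cons.1 hD
    exact .cons (fun _ hc => hD.columnPositions_lt hc) (ih hD)

theorem map_val_freeColumns (hpiv : StrictMono piv) :
    (freeColumns piv).map Fin.val = columnPositions (diagramOf piv) := by
  suffices h : ∀ L : List (Fin n), L <:+ freeColumns piv → L.map Fin.val =
      columnPositions (L.map fun c => (rowsBefore piv c).length) from h _ List.suffix_rfl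
  intro L hL
  induction L with
  | nil => rfl
  | cons c L ih =>
    have hL' := (List.suffix_cons c L).trans hL
    have hc := length_rowsBefore_add_length hpiv (hL'.sublist.nodup (nodup_freeColumns piv))
      (mem_tail_freeColumns hL)
    simp only [List.map_cons, columnPositions, ih hL', List.length_map, hc]

theorem diagramOf_injOn {piv' : Fin k → Fin n} (hpiv : StrictMono piv) (hpiv' : StrictMono piv')
    (h : diagramOf piv = diagramOf piv') : piv = piv' := by
  refine freeColumns_injOn hpiv hpiv' (List.map_injective_iff.2 Fin.val_injective ?_)
  rw [map_val_freeColumns hpiv, map_val_freeColumns hpiv', h]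

theorem isDiagram_diagramOf (piv : Fin k → Fin n) : IsDiagram k (diagramOf piv) := by
  refine List.Pairwise.isChain (List.pairwise_cons.2 ⟨fun d hd => ?_, ?_⟩)
  · obtain ⟨c, -, rfl⟩ := List.mem_map.1 hd
    exact (List.length_filter_le _ _).trans_eq (List.length_finRange)
  · refine (pairwise_freeColumns piv).map _ fun c c' hc => ?_
    refine (List.monotone_filter_right _ fun r hr => ?_).length_le
    simp only [decide_eq_true_eq] at hr ⊢
    exact hr.trans hc

theorem exists_diagramOf_eq (hk : k ≤ n) {D : List ℕ} (hD : IsDiagram k D)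
    (hlen : D.length = n - k) : ∃ piv : Fin k → Fin n, StrictMono piv ∧ diagramOf piv = D := by
  have hlt : ∀ c ∈ columnPositions D, c < n := fun c hc => by
    have := hD.columnPositions_lt hc
    lia
  obtain ⟨L, hL⟩ : ∃ L : List (Fin n), L.map Fin.val = columnPositions D := by
    lift columnPositions D to List (Fin n) using hlt with L
    exact ⟨L, rfl⟩
  have hsorted : L.Pairwise (· > ·) := by
    have := hD.pairwise_columnPositions
    rwa [← hL, List.pairwise_map] at this
  obtain ⟨piv, hpiv, hfree⟩ := exists_freeColumns_eq hk hsorted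
    (by rw [← List.length_map Fin.val, hL, length_columnPositions, hlen])
  refine ⟨piv, hpiv, columnPositions_injective ?_⟩
  rw [← map_val_freeColumns hpiv, hfree, hL]

end Columns

section Cells

variable {F : Type*} {q n k : ℕ} {piv : Fin k → Fin n}

/-- The positions `(c, r)` in the matrix of the dots of the Ferrers diagram, in the order of the
entries vector. -/
def tableauCells (piv : Fin k → Fin n) : List (Fin n × Fin k) :=
  (freeColumns piv).flatMap fun c => (rowsBefore piv c).map (Prod.mk c)

theorem mem_tableauCells {c : Fin n} {r : Fin k} :
    (c, r) ∈ tableauCells piv ↔ (∀ s, piv s ≠ c) ∧ piv r < c := by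
  simp [tableauCells, mem_freeColumns, mem_rowsBefore]

theorem length_tableauCells (piv : Fin k → Fin n) :
    (tableauCells piv).length = (diagramOf piv).sum := by
  simp [tableauCells, diagramOf, List.length_flatMap]

theorem nodup_tableauCells (piv : Fin k → Fin n) : (tableauCells piv).Nodup := by
  refine List.nodup_flatMap.2 ⟨fun c _ => (nodup_rowsBefore piv c).map (Prod.mk_right_injective c),
    (nodup_freeColumns piv).imp fun hne => ?_⟩
  simp only [Function.onFun, List.disjoint_left, List.mem_map]
  grind

theorem entriesOf_eq_map_tableauCells (e : F ≃ Fin q) (M : Matrix (Fin k) (Fin n) F)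
    (piv : Fin k → Fin n) :
    entriesOf e M piv = (tableauCells piv).map fun p => (e (M p.2 p.1) : ℕ) := by
  simp [entriesOf, tableauCells, List.map_flatMap, Function.comp_def]

theorem isForm_diagramOf_entriesOf (e : F ≃ Fin q) (M : Matrix (Fin k) (Fin n) F)
    (hpiv : StrictMono piv) : IsForm q k (n - k) (diagramOf piv) (entriesOf e M piv) where
  length_diagram := by rw [diagramOf, List.length_map, length_freeColumns hpiv]
  isDiagram := isDiagram_diagramOf piv
  length_entries := by
    rw [entriesOf_eq_map_tableauCells, List.length_map, length_tableauCells]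
  isDigits d hd := by
    rw [entriesOf_eq_map_tableauCells] at hd
    obtain ⟨p, -, rfl⟩ := List.mem_map.1 hd
    exact Fin.is_lt _

theorem exists_map_eq_of_nodup {α β : Type*} [Nonempty β] {l : List α} (hl : l.Nodup)
    {x : List β} (hx : x.length = l.length) : ∃ f : α → β, l.map f = x := by
  classical
  inhabit β
  refine ⟨fun a => x.getD (l.idxOf a) default, List.ext_getElem (by simp [hx]) fun i hi hi' => ?_⟩
  rw [List.getElem_map, hl.idxOf_getElem, List.getD_eq_getElem _ _ hi']

end Cells

section Matrices

variable {F : Type*} [Field F] {q n k : ℕ} {M M' : Matrix (Fin k) (Fin n) F}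
  {piv piv' : Fin k → Fin n}

theorem IsRREF.eq_of_form_eq {e : F ≃ Fin q} (h : IsRREF M piv) (h' : IsRREF M' piv')
    (hD : diagramOf piv = diagramOf piv') (hx : entriesOf e M piv = entriesOf e M' piv') :
    M = M' := by
  obtain rfl := diagramOf_injOn h.pivot_strictMono h'.pivot_strictMono hD
  rw [entriesOf_eq_map_tableauCells, entriesOf_eq_map_tableauCells, List.map_inj_left] at hx
  ext r c
  by_cases hpivot : ∃ s, piv s = c
  · obtain ⟨s, rfl⟩ := hpivot
    rcases eq_or_ne r s with rfl | hrs
    · rw [h.pivot_one, h'.pivot_one]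
    · rw [h.pivot_column s r hrs, h'.pivot_column s r hrs]
  · push Not at hpivot
    rcases (hpivot r).lt_or_gt with hlt | hlt
    · exact e.injective (Fin.val_injective (hx (c, r) (mem_tableauCells.2 ⟨hpivot, hlt⟩)))
    · rw [h.zero_left r c hlt, h'.zero_left r c hlt]

theorem exists_isRREF_of_isForm (e : F ≃ Fin q) (hk : k ≤ n) {D x : List ℕ}
    (hform : IsForm q k (n - k) D x) : ∃ (M : Matrix (Fin k) (Fin n) F) (piv : Fin k → Fin n),
      IsRREF M piv ∧ D = diagramOf piv ∧ x = entriesOf e M piv := by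
  obtain ⟨piv, hpiv, rfl⟩ := exists_diagramOf_eq hk hform.isDiagram hform.length_diagram
  have hlen := hform.length_entries
  lift x to List (Fin q) using hform.isDigits
  have : Nonempty (Fin q) := ⟨e 0⟩
  obtain ⟨f, hf⟩ := exists_map_eq_of_nodup (nodup_tableauCells piv) (x := x)
    (by rw [length_tableauCells, ← hlen, List.length_map])
  let M : Matrix (Fin k) (Fin n) F := fun r c =>
    if (c, r) ∈ tableauCells piv then e.symm (f (c, r)) else if piv r = c then 1 else 0
  have piv_notMem (r s : Fin k) : (piv r, s) ∉ tableauCells piv := fun hmem =>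
    (mem_tableauCells.1 hmem).1 r rfl
  refine ⟨M, piv, ⟨hpiv, fun r c hc => ?_, fun r => ?_, fun r s hs => ?_⟩, rfl, ?_⟩
  · have hmem : (c, r) ∉ tableauCells piv := fun hmem => (mem_tableauCells.1 hmem).2.not_gt hc
    simp [M, hmem, hc.ne']
  · simp [M, piv_notMem]
  · simp [M, piv_notMem, hpiv.injective.ne hs]
  · rw [entriesOf_eq_map_tableauCells, ← hf, List.map_map]
    refine List.map_congr_left fun p hp => ?_
    simp [M, hp]

namespace IsRREF

theorem sum_smul_row_apply_pivot (h : IsRREF M piv) (a : Fin k → F) (r : Fin k) :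
    (∑ s, a s • M.row s) (piv r) = a r := by
  rw [Finset.sum_apply, Finset.sum_eq_single r]
  · simp [Matrix.row, h.pivot_one]
  · intro s _ hs
    simp [Matrix.row, h.pivot_column r s hs]
  · simp

theorem linearIndependent_row (h : IsRREF M piv) : LinearIndependent F M.row :=
  Fintype.linearIndependent_iff.2 fun a ha r => by
    rw [← h.sum_smul_row_apply_pivot a r, ha, Pi.zero_apply]

theorem finrank_span_row (h : IsRREF M piv) :
    Module.finrank F (Submodule.span F (Set.range M.row)) = k := by
  rw [finrank_span_eq_card h.linearIndependent_row, Fintype.card_fin]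

theorem eq_sum_of_mem_span (h : IsRREF M piv) {v : Fin n → F}
    (hv : v ∈ Submodule.span F (Set.range M.row)) : v = ∑ r, v (piv r) • M.row r := by
  obtain ⟨a, rfl⟩ := (Submodule.mem_span_range_iff_exists_fun F).1 hv
  simp only [h.sum_smul_row_apply_pivot]

theorem exists_leading_pivot (h : IsRREF M piv) {v : Fin n → F}
    (hv : v ∈ Submodule.span F (Set.range M.row)) (hv0 : v ≠ 0) :
    ∃ r, v (piv r) ≠ 0 ∧ ∀ c < piv r, v c = 0 := by
  have hsum := h.eq_sum_of_mem_span hv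
  have hne : {r | v (piv r) ≠ 0}.Nonempty := by
    by_contra! hempty
    have hzero (r : Fin k) : v (piv r) = 0 := by_contra (Set.eq_empty_iff_forall_notMem.1 hempty r)
    exact hv0 (hsum.trans (Finset.sum_eq_zero fun r _ => by rw [hzero r, zero_smul]))
  obtain ⟨r, hr, hmin⟩ := wellFounded_lt.has_min _ hne
  refine ⟨r, hr, fun c hc => ?_⟩
  rw [hsum, Finset.sum_apply]
  refine Finset.sum_eq_zero fun s _ => ?_
  rw [Pi.smul_apply, smul_eq_mul]
  rcases lt_or_ge s r with hsr | hrs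
  · rw [by_contra fun hs => hmin s hs hsr, zero_mul]
  · rw [Matrix.row, h.zero_left s c (hc.trans_le (h.pivot_strictMono.monotone hrs)), mul_zero]

theorem range_pivot_subset (h : IsRREF M piv) (h' : IsRREF M' piv')
    (hspan : Submodule.span F (Set.range M.row) = Submodule.span F (Set.range M'.row)) :
    Set.range piv ⊆ Set.range piv' := by
  rintro _ ⟨r, rfl⟩
  have hone : M.row r (piv r) = 1 := h.pivot_one r
  obtain ⟨r', hne, hzero⟩ := h'.exists_leading_pivot (v := M.row r)
    (hspan ▸ Submodule.subset_span ⟨r, rfl⟩)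
    fun h0 => one_ne_zero (hone.symm.trans (congrFun h0 (piv r)))
  refine ⟨r', (lt_trichotomy (piv r) (piv' r')).elim3 (fun hlt => ?_) Eq.symm fun hlt => ?_⟩
  · exact absurd (hone.symm.trans (hzero _ hlt)) one_ne_zero
  · exact absurd (h.zero_left r _ hlt) hne

theorem eq_of_span_eq (h : IsRREF M piv) (h' : IsRREF M' piv')
    (hspan : Submodule.span F (Set.range M.row) = Submodule.span F (Set.range M'.row)) :
    M = M' ∧ piv = piv' := by
  obtain rfl : piv = piv' := (StrictMono.range_inj h.pivot_strictMono h'.pivot_strictMono).1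
    ((h.range_pivot_subset h' hspan).antisymm (h'.range_pivot_subset h hspan.symm))
  refine ⟨Matrix.ext fun r c => congrFun ?_ c, rfl⟩
  calc M.row r = ∑ s, M.row r (piv s) • M'.row s :=
        h'.eq_sum_of_mem_span (hspan ▸ Submodule.subset_span ⟨r, rfl⟩)
    _ = ∑ s, M'.row r (piv s) • M'.row s := by
        refine Finset.sum_congr rfl fun s _ => ?_
        rcases eq_or_ne r s with rfl | hrs
        · rw [Matrix.row, Matrix.row, h.pivot_one, h'.pivot_one]
        · rw [Matrix.row, Matrix.row, h.pivot_column s r hrs, h'.pivot_column s r hrs]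
    _ = M'.row r := (h'.eq_sum_of_mem_span (Submodule.subset_span ⟨r, rfl⟩)).symm

end IsRREF

section Forms

variable {e : F ≃ Fin q} {X Y : Grass F n k} {D x D' x' : List ℕ}

theorem HasTableauxForm.isForm (h : HasTableauxForm e X D x) : IsForm q k (n - k) D x := by
  obtain ⟨M, piv, hM, -, rfl, rfl⟩ := h
  exact isForm_diagramOf_entriesOf e M hM.pivot_strictMono

theorem HasTableauxForm.form_unique (h : HasTableauxForm e X D x)
    (h' : HasTableauxForm e X D' x') : D = D' ∧ x = x' := by
  obtain ⟨M, piv, hM, hspan, rfl, rfl⟩ := h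
  obtain ⟨M', piv', hM', hspan', rfl, rfl⟩ := h'
  obtain ⟨rfl, rfl⟩ := hM.eq_of_span_eq hM' (hspan.trans hspan'.symm)
  exact ⟨rfl, rfl⟩

theorem HasTableauxForm.subspace_unique (h : HasTableauxForm e X D x)
    (h' : HasTableauxForm e Y D x) : X = Y := by
  obtain ⟨M, piv, hM, hspan, hD, hx⟩ := h
  obtain ⟨M', piv', hM', hspan', hD', hx'⟩ := h'
  obtain rfl := hM.eq_of_form_eq hM' (hD.symm.trans hD') (hx.symm.trans hx')
  exact Subtype.ext (hspan.symm.trans hspan')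

theorem IsForm.exists_hasTableauxForm (e : F ≃ Fin q) (hk : k ≤ n)
    (h : IsForm q k (n - k) D x) : ∃ X : Grass F n k, HasTableauxForm e X D x := by
  obtain ⟨M, piv, hM, hD, hx⟩ := exists_isRREF_of_isForm e hk h
  exact ⟨⟨_, hM.finrank_span_row⟩, M, piv, hM, rfl, hD, hx⟩

theorem HasTableauxForm.grassLT_iff_formRank_lt (hq : 1 < q) (h : HasTableauxForm e Y D' x')
    (hX : HasTableauxForm e X D x) :
    GrassLT e Y X ↔ formRank q k (n - k) D' x' < formRank q k (n - k) D x := by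
  rw [← h.isForm.tableauxLT_iff_formRank_lt hq hX.isForm]
  refine ⟨fun ⟨D₁, x₁, D₂, x₂, h₁, h₂, hlt⟩ => ?_, fun hlt => ⟨_, _, _, _, h, hX, hlt⟩⟩
  obtain ⟨rfl, rfl⟩ := h₁.form_unique h
  obtain ⟨rfl, rfl⟩ := h₂.form_unique hX
  exact hlt

theorem indF_eq_formRank (hq : 1 < q) (hk : k ≤ n) (hX : HasTableauxForm e X D x)
    (hsurj : ∀ j < formRank q k (n - k) D x, ∃ D' x', IsForm q k (n - k) D' x' ∧
      formRank q k (n - k) D' x' = j) :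
    indF e X = formRank q k (n - k) D x := by
  have hex (j : Fin (formRank q k (n - k) D x)) : ∃ (Y : Grass F n k) (D' x' : List ℕ),
      HasTableauxForm e Y D' x' ∧ formRank q k (n - k) D' x' = j := by
    obtain ⟨D', x', hform, hrank⟩ := hsurj j j.2
    obtain ⟨Y, hY⟩ := hform.exists_hasTableauxForm e hk
    exact ⟨Y, D', x', hY, hrank⟩
  choose Y D' x' hY hrank using hex
  have hlt (j) : GrassLT e (Y j) X :=
    ((hY j).grassLT_iff_formRank_lt hq hX).2 ((hrank j).trans_lt j.2)
  have hbij : Function.Bijective fun j => (⟨Y j, hlt j⟩ : {Z : Grass F n k // GrassLT e Z X}) := by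
    refine ⟨fun i j hij => Fin.ext ?_, fun ⟨Z, hZX⟩ => ?_⟩
    · have hYij : Y i = Y j := congrArg Subtype.val hij
      obtain ⟨hD, hx⟩ := (hYij ▸ hY i).form_unique (hY j)
      rw [← hrank i, ← hrank j, hD, hx]
    · obtain ⟨D₁, x₁, -, -, hZ, -, -⟩ := id hZX
      let j : Fin (formRank q k (n - k) D x) := ⟨_, (hZ.grassLT_iff_formRank_lt hq hX).1 hZX⟩
      obtain ⟨hD, hx⟩ := (hY j).isForm.formRank_injOn hq hZ.isForm (hrank j)
      exact ⟨j, Subtype.ext ((hD ▸ hx ▸ hY j).subspace_unique hZ)⟩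
  rw [indF, ← Nat.card_congr (Equiv.ofBijective _ hbij), Nat.card_fin]

end Forms

end Matrices

/-! ## The table of partition numbers -/

namespace Counted

section Table

variable {q η N j l i L W : ℕ} {T : Table}

theorem idxLen_zero (q : ℕ) : idxLen q 0 = 0 := by simp [idxLen]

theorem forLoop_induction {σ : Type} {body : ℕ → σ → Counted σ} {count start : ℕ} {s : σ}
    (I : ℕ → σ → Prop) (hI : I start s)
    (hstep : ∀ j s, j < start + count → I j s → I (j + 1) (body j s).val) :
    I (start + count) (forLoop q body count start s).val := by
  induction count generalizing start s with
  | zero => simpa [forLoop] using hI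
  | succ c ih =>
    have hrest := ih (hstep start s (by lia) hI) fun j s hj => hstep j s (by lia)
    rwa [add_right_comm] at hrest

theorem cost_forLoop_le {σ : Type} {body : ℕ → σ → Counted σ} {count start B : ℕ} {s : σ}
    (I : ℕ → σ → Prop) (hI : I start s)
    (hstep : ∀ j s, j < start + count → I j s → I (j + 1) (body j s).val)
    (hcost : ∀ j s, j < start + count → I j s → (body j s).cost ≤ B)
    (hL : ∀ a ≤ start + count, idxLen q a ≤ L) :
    (forLoop q body count start s).cost ≤ count * (B + (4 * L + 2)) := by
  induction count generalizing start s with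
  | zero => simp [forLoop]
  | succ c ih =>
    have hfirst := hcost start s (by lia) hI
    have hrest := ih (hstep start s (by lia) hI) (fun j s hj => hstep j s (by lia))
      (fun j s hj => hcost j s (by lia)) (fun a ha => hL a (by lia))
    have := hL start (by lia)
    have := hL 1 (by lia)
    have := hL (start + 1) (by lia)
    have := hL (start + c + 1) (by lia)
    simp only [forLoop, cost_bind, idxAdd, idxEq]
    lia

/-- The innermost loop of `buildTable`. -/
def fillRow (q N j l : ℕ) : Table → Counted Table := forLoop q (fillCell q j l) (N + 1) 0

/-- The two inner loops of `buildTable`. -/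
def fillLayer (q η N j : ℕ) : Table → Counted Table := forLoop q (fillRow q N j) (η + 1) 0

/-- The cells that are filled before `(j, l, i)`, in lexicographic order, hold their partition
numbers. -/
def Filled (q η N : ℕ) (T : Table) (j l i : ℕ) : Prop :=
  ∀ a b c, b ≤ η → c ≤ N → (a < j ∨ a = j ∧ (b < l ∨ b = l ∧ c < i)) →
    T (a, b, c) = Nat.digits q (boxCount a b c)

theorem val_fillCell (hq : 1 < q) (hT : Filled q η N T j l i) (hl : l ≤ η) (hi : i ≤ N) :
    (fillCell q j l i T).val = Function.update T (j, l, i) (Nat.digits q (boxCount j l i)) := by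
  obtain rfl | hi0 := eq_or_ne i 0
  · simp [fillCell, idxEq, writeCell, Nat.digits_of_lt q 1 one_ne_zero hq]
  obtain _ | j := j
  · simp [fillCell, idxEq, writeCell, hi0, boxCount_zero_left]
  obtain _ | l := l
  · simp [fillCell, idxEq, writeCell, hi0, boxCount_zero_right]
  have habove : T (j, l + 1, i) = Nat.digits q (boxCount j (l + 1) i) :=
    hT _ _ _ hl hi (by lia)
  by_cases hij : i < j + 1
  · simp [fillCell, idxEq, idxLt, idxSub, readCell, writeCell, hi0, hij, hij.not_ge, habove,
      boxCount_succ_succ]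
  · have hleft : T (j + 1, l, i - (j + 1)) = Nat.digits q (boxCount (j + 1) l (i - (j + 1))) :=
      hT _ _ _ (by lia) (by lia) (by lia)
    simp [fillCell, idxEq, idxLt, idxSub, readCell, writeCell, hi0, hij, not_lt.1 hij, habove,
      hleft, boxCount_succ_succ, val_qAdd_digits hq]

theorem filled_fillCell (hq : 1 < q) (hT : Filled q η N T j l i) (hl : l ≤ η) (hi : i ≤ N) :
    Filled q η N (fillCell q j l i T).val j l (i + 1) := by
  intro a b c hb hc habc
  rw [val_fillCell hq hT hl hi, Function.update_apply]
  split_ifs with hcell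
  · grind
  · exact hT a b c hb hc (by grind)

theorem filled_fillRow (hq : 1 < q) (hT : Filled q η N T j l 0) (hl : l ≤ η) :
    Filled q η N (fillRow q N j l T).val j (l + 1) 0 := by
  have hrow := forLoop_induction (q := q) (body := fillCell q j l) (count := N + 1)
    (fun i T => Filled q η N T j l i) hT fun i T hi hT => filled_fillCell hq hT hl (by lia)
  exact fun a b c hb hc habc => hrow a b c hb hc (by lia)

theorem filled_fillLayer (hq : 1 < q) (hT : Filled q η N T j 0 0) :
    Filled q η N (fillLayer q η N j T).val (j + 1) 0 0 := by
  have hlayer := forLoop_induction (q := q) (body := fillRow q N j) (count := η + 1)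
    (fun l T => Filled q η N T j l 0) hT fun l T hl hT => filled_fillRow hq hT (by lia)
  exact fun a b c hb hc habc => hlayer a b c hb hc (by lia)

theorem filled_zero (q η N : ℕ) (T : Table) : Filled q η N T 0 0 0 := fun a b c _ _ h => by lia

/-- The cells in the range of the loops hold their partition numbers. -/
def IsTable (q k η N : ℕ) (T : Table) : Prop :=
  ∀ a b c, a ≤ k → b ≤ η → c ≤ N → T (a, b, c) = Nat.digits q (boxCount a b c)

theorem isTable_buildTable (hq : 1 < q) (k η N : ℕ) :
    IsTable q k η N (buildTable q k η N).val := by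
  have htable := forLoop_induction (q := q) (body := fillLayer q η N) (count := k + 1)
    (fun j T => Filled q η N T j 0 0) (filled_zero q η N fun _ => [])
    fun j T _ hT => filled_fillLayer hq hT
  exact fun a b c ha hb hc => htable a b c hb hc (by lia)

theorem cost_fillCell_le (hq : 1 < q) (hT : Filled q η N T j l i) (hl : l ≤ η) (hi : i ≤ N)
    (hL : ∀ a, a ≤ j ∨ a ≤ l ∨ a ≤ i → idxLen q a ≤ L)
    (hW : ∀ a b c, c ≤ N → (Nat.digits q (boxCount a b c)).length ≤ W) :
    (fillCell q j l i T).cost ≤ 20 * L + 5 * W + 12 := by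
  have := hL j (by lia)
  have := hL l (by lia)
  have := hL i (by lia)
  obtain rfl | hi0 := eq_or_ne i 0
  · simp [fillCell, idxEq, writeCell, addrCost, idxLen_zero]
    lia
  obtain _ | j := j
  · simp [fillCell, idxEq, writeCell, addrCost, hi0, idxLen_zero]
    lia
  obtain _ | l := l
  · simp [fillCell, idxEq, writeCell, addrCost, hi0, idxLen_zero]
    lia
  have := hL 1 (by lia)
  have := hL j (by lia)
  have habove : T (j, l + 1, i) = Nat.digits q (boxCount j (l + 1) i) :=
    hT _ _ _ hl hi (by lia)
  have := hW j (l + 1) i hi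
  by_cases hij : i < j + 1
  · simp [fillCell, idxEq, idxLt, idxSub, readCell, writeCell, addrCost, hi0, hij, habove,
      idxLen_zero]
    lia
  · have hleft : T (j + 1, l, i - (j + 1)) = Nat.digits q (boxCount (j + 1) l (i - (j + 1))) :=
      hT _ _ _ (by lia) (by lia) (by lia)
    have := hL l (by lia)
    have := hL (i - (j + 1)) (by lia)
    have := hW (j + 1) l (i - (j + 1)) (by lia)
    have hsum := hW (j + 1) (l + 1) i hi
    rw [boxCount_succ_succ, if_pos (not_lt.1 hij)] at hsum
    have := cost_qAdd_le q (Nat.digits q (boxCount (j + 1) l (i - (j + 1))))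
      (Nat.digits q (boxCount j (l + 1) i))
    simp [fillCell, idxEq, idxLt, idxSub, readCell, writeCell, addrCost, hi0, hij, habove, hleft,
      val_qAdd_digits hq, idxLen_zero]
    lia

theorem cost_buildTable_le {k : ℕ} (hq : 1 < q)
    (hL : ∀ a, a ≤ k + 1 ∨ a ≤ η + 1 ∨ a ≤ N + 1 → idxLen q a ≤ L)
    (hW : ∀ a b c, c ≤ N → (Nat.digits q (boxCount a b c)).length ≤ W) :
    (buildTable q k η N).cost ≤ (k + 1) * ((η + 1) * ((N + 1) *
      (20 * L + 5 * W + 12 + (4 * L + 2)) + (4 * L + 2)) + (4 * L + 2)) := by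
  refine cost_forLoop_le (fun j T => Filled q η N T j 0 0) (filled_zero q η N _)
    (fun j T _ hT => filled_fillLayer hq hT) (fun j T hj hT => ?_) (fun a ha => hL a (by lia))
  refine cost_forLoop_le (fun l T => Filled q η N T j l 0) hT
    (fun l T hl hT => filled_fillRow hq hT (by lia)) (fun l T hl hT => ?_)
    (fun a ha => hL a (by lia))
  refine cost_forLoop_le (fun i T => Filled q η N T j l i) hT
    (fun i T hi hT => filled_fillCell hq hT (by lia) (by lia)) (fun i T hi hT => ?_)
    (fun a ha => hL a (by lia))
  exact cost_fillCell_le hq hT (by lia) (by lia) (fun a ha => hL a (by lia)) hW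

end Table

end Counted

/-! ## From an index to a tableaux form -/

namespace Counted

section Search

variable {q k η N : ℕ} {T : Table} {m j S : ℕ}

theorem val_lookupN (hT : IsTable q k η N T) {a : ℕ} (ha : a ≤ k) (hS : S ≤ m) (hm : m ≤ N) :
    (lookupN q η T m j S a).val = Nat.digits q (colCount (η - j) (m - S) a) := by
  by_cases h : m < S + a
  · simp [lookupN, idxAdd, idxLt, h, colCount, show ¬a ≤ m - S by lia]
  · simp [lookupN, idxAdd, idxLt, idxSub, readCell, h, colCount, show a ≤ m - S by lia,
      Nat.sub_sub, hT a (η - j) (m - (S + a)) ha (by lia) (by lia)]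

/-- The specification of `whileB`, where `b` columns follow the current one: the chosen height is
`w.1`, and `w.2` is what remains of the index `h`. -/
structure IsColumnChoice (q b m S a : ℕ) (h : List ℕ) (w : ℕ × List ℕ) : Prop where
  height_le : w.1 ≤ a
  add_height_le : S + w.1 ≤ m
  isDigits : IsDigits q w.2
  lt_boxCount : Nat.ofDigits q w.2 < boxCount w.1 b (m - (S + w.1))
  sum_add : ∑ c ∈ Finset.Ioc w.1 a, colCount b (m - S) c + Nat.ofDigits q w.2 = Nat.ofDigits q h

theorem isColumnChoice_val_whileB (hq : 1 < q) (hT : IsTable q k η N T) (hS : S ≤ m) (hm : m ≤ N)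
    {a : ℕ} (ha : a ≤ k) {h : List ℕ} (hd : IsDigits q h)
    (hh : Nat.ofDigits q h < boxCount a (η - j + 1) (m - S)) :
    IsColumnChoice q (η - j) m S a h (whileB q η T m j S a h).val := by
  induction a generalizing h with
  | zero =>
    rw [boxCount_zero_eq_colCount] at hh
    simp only [whileB, val_bind, val_pure]
    exact ⟨le_rfl, hS, hd, by simpa [colCount] using hh, by simp⟩
  | succ a ih =>
    simp only [whileB, val_bind, val_lookupN hT ha hS hm, idxSub]
    set V := colCount (η - j) (m - S) (a + 1) with hV
    have hless := val_qLess_iff hd (isDigits_digits hq V)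
    rw [Nat.ofDigits_digits] at hless
    split_ifs with hlt
    · rw [hless] at hlt
      have hle : a + 1 ≤ m - S := by
        by_contra hcon
        simp [hV, colCount, hcon] at hlt
      rw [hV, colCount, if_pos hle, Nat.sub_sub] at hlt
      exact ⟨le_rfl, by simp only [val_pure]; lia, hd, hlt, by simp⟩
    · rw [hless, not_lt] at hlt
      have hrest : Nat.ofDigits q (qSub q h (Nat.digits q V)).val + V = Nat.ofDigits q h := by
        have hsub := ofDigits_val_qSubBorrow_add hd (isDigits_digits hq V)
          (length_digits_le_of_le_ofDigits hq hd hlt) zero_le_one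
          (by rwa [Nat.ofDigits_digits, add_zero])
        rwa [Nat.ofDigits_digits, add_zero] at hsub
      rw [boxCount_succ_eq_colCount_add] at hh
      have hw := ih (by lia) (h := (qSub q h (Nat.digits q V)).val)
        (isDigits_val_qSubBorrow _ 0 hd) (by lia)
      refine ⟨hw.height_le.trans a.le_succ, hw.add_height_le, hw.isDigits, hw.lt_boxCount, ?_⟩
      rw [val_bind, val_bind, Finset.sum_Ioc_succ_top hw.height_le, add_right_comm, hw.sum_add,
        hrest]

/-- `D` is the diagram with `b` columns of height at most `a` and `M` dots that is preceded by
`r` others. -/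
structure HasDiagRank (a b M r : ℕ) (D : List ℕ) : Prop where
  length_eq : D.length = b
  isDiagram : IsDiagram a D
  sum_eq : D.sum = M
  diagRank_eq : diagRank a D = r

theorem IsColumnChoice.hasDiagRank_cons {a b : ℕ} {h : List ℕ} {w : ℕ × List ℕ} {D : List ℕ}
    (hw : IsColumnChoice q b m S a h w)
    (hD : HasDiagRank w.1 b (m - (S + w.1)) (Nat.ofDigits q w.2) D) :
    HasDiagRank a (b + 1) (m - S) (Nat.ofDigits q h) (w.1 :: D) := by
  have hsum : w.1 + D.sum = m - S := by
    have := hw.add_height_le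
    rw [hD.sum_eq]
    lia
  refine ⟨by rw [List.length_cons, hD.length_eq], isDiagram_cons.2 ⟨hw.height_le, hD.isDiagram⟩,
    by rw [List.sum_cons, hsum], ?_⟩
  rw [diagRank, hD.length_eq, hD.diagRank_eq, hsum, hw.sum_add]

theorem HasDiagRank.cons_zero {a b r : ℕ} {D : List ℕ} (hD : HasDiagRank 0 b 0 r D) :
    HasDiagRank a (b + 1) 0 r (0 :: D) := by
  refine ⟨by rw [List.length_cons, hD.length_eq], isDiagram_cons.2 ⟨a.zero_le, hD.isDiagram⟩,
    by rw [List.sum_cons, hD.sum_eq], ?_⟩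
  have hzero : ∑ c ∈ Finset.Ioc 0 a, colCount b 0 c = 0 := Finset.sum_eq_zero fun c hc => by
    simp [colCount, (Finset.mem_Ioc.1 hc).1.ne']
  rw [diagRank, hD.length_eq, hD.sum_eq, hzero, hD.diagRank_eq, zero_add]

theorem hasDiagRank_val_columnsB (hq : 1 < q) (hT : IsTable q k η N T) (hm : m ≤ N) {count a : ℕ}
    (hj : j + count = η + 1) (ha : a ≤ k) (hS : S ≤ m) {h : List ℕ} (hd : IsDigits q h)
    (hh : Nat.ofDigits q h < boxCount a count (m - S)) :
    HasDiagRank a count (m - S) (Nat.ofDigits q h) (columnsB q η T m count j a S h).val := by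
  induction count generalizing j a S h with
  | zero =>
    rw [boxCount_zero_right] at hh
    have hmS : m - S = 0 := by
      by_contra hne
      simp [hne] at hh
    rw [if_pos hmS, Nat.lt_one_iff] at hh
    rw [hmS, hh]
    exact ⟨rfl, isDiagram_nil a, rfl, rfl⟩
  | succ c ih =>
    by_cases hSm : S = m
    · subst hSm
      rw [Nat.sub_self, boxCount_zero] at hh
      have hrest := ih (j := j + 1) (a := 0) (by lia) k.zero_le hS hd
        (by rwa [Nat.sub_self, boxCount_zero])
      rw [Nat.sub_self] at hrest ⊢
      simpa [columnsB, idxAdd, idxLt, idxEq, idxWrite] using hrest.cons_zero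
    · have hb : η - j = c := by lia
      have hw := isColumnChoice_val_whileB (j := j) hq hT hS hm ha hd (by rwa [hb])
      rw [hb] at hw
      have hrest := ih (j := j + 1) (by lia) (hw.height_le.trans ha) hw.add_height_le hw.isDigits
        hw.lt_boxCount
      simpa [columnsB, idxAdd, idxLt, idxEq, idxWrite, hSm] using hw.hasDiagRank_cons hrest

theorem hasDiagRank_val_algorithmB (hq : 1 < q) (hT : IsTable q k η N T) (hm : m ≤ N)
    {h : List ℕ} (hd : IsDigits q h) (hh : Nat.ofDigits q h < boxCount k η m) :
    HasDiagRank k η m (Nat.ofDigits q h) (algorithmB q k η T m h).val := by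
  cases η with
  | zero => exact hasDiagRank_val_columnsB (j := 1) hq hT hm rfl le_rfl m.zero_le hd hh
  | succ c =>
    have hw := isColumnChoice_val_whileB (j := 1) hq hT m.zero_le hm le_rfl hd hh
    rw [Nat.add_sub_cancel] at hw
    have hrest := hasDiagRank_val_columnsB (j := 2) hq hT hm (by lia) hw.height_le
      hw.add_height_le hw.isDigits hw.lt_boxCount
    simpa [algorithmB, idxWrite] using hw.hasDiagRank_cons hrest

theorem isForm_val_algorithmB_val_qModPow (hq : 1 < q) (hT : IsTable q k η (k * η) T)
    (hm : m ≤ k * η) {y : List ℕ} (hd : IsDigits q y)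
    (hy : Nat.ofDigits q y < boxCount k η m * q ^ m) :
    let D := (algorithmB q k η T m (qDivPow m y).val).val
    let x := (qModPow m y).val.reverse
    IsForm q k η D x ∧ formRank q k η D x = largeCount q k η (m + 1) + Nat.ofDigits q y := by
  intro D x
  have hsplit := ofDigits_val_qModPow_add q m y
  have hdiv : Nat.ofDigits q (qDivPow m y).val < boxCount k η m :=
    Nat.lt_of_mul_lt_mul_right (a := q ^ m) (by lia)
  have hD : HasDiagRank k η m (Nat.ofDigits q (qDivPow m y).val) D :=
    hasDiagRank_val_algorithmB hq hT hm (fun d hd' => hd d (List.mem_of_mem_drop hd')) hdiv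
  have hmod : IsDigits q (qModPow m y).val :=
    IsDigits.append (fun d hd' => hd d (List.mem_of_mem_take hd'))
      (isDigits_replicate_zero (by lia) _)
  have hlen : (qModPow m y).val.length = m := by
    simp [qModPow]
    lia
  refine ⟨⟨hD.length_eq, hD.isDiagram, by rw [List.length_reverse, hlen, hD.sum_eq],
    fun d hd' => hmod d (List.mem_reverse.1 hd')⟩, ?_⟩
  rw [formRank, hD.sum_eq, hD.diagRank_eq, vecValue, List.reverse_reverse, add_comm (_ * _),
    hsplit]

theorem exists_val_searchC (hq : 1 < q) (hT : IsTable q k η (k * η) T) {count : ℕ}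
    (hj : j + count = k * η + 1) {y : List ℕ} (hd : IsDigits q y)
    (hy : largeCount q k η count + Nat.ofDigits q y < largeCount q k η 0) :
    ∃ D x, (searchC q k η (k * η) T count j y).val = some (D, x) ∧ IsForm q k η D x ∧
      formRank q k η D x = largeCount q k η count + Nat.ofDigits q y := by
  induction count generalizing j y with
  | zero => lia
  | succ c ih =>
    have hc : k * η - j = c := by lia
    set A := (qShift c (Nat.digits q (boxCount k η c))).val with hA
    have hAd : IsDigits q A := (isDigits_replicate_zero (by lia) c).append (isDigits_digits hq _)
    have hAvalue : Nat.ofDigits q A = boxCount k η c * q ^ c := by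
      rw [hA, ofDigits_val_qShift, Nat.ofDigits_digits]
    have hless := val_qLess_iff hd hAd
    simp only [searchC, val_bind, idxSub, readCell, hc, idxAdd, idxLt,
      hT k η c le_rfl le_rfl (by lia), ← hA]
    split_ifs with hlt
    · rw [hless, hAvalue] at hlt
      exact ⟨_, _, rfl, isForm_val_algorithmB_val_qModPow hq hT (by lia) hd hlt⟩
    · rw [hless, not_lt] at hlt
      have hlen : A.length ≤ y.length := by
        rw [hA, qShift, List.length_append, List.length_replicate]
        exact add_length_digits_le_of_mul_pow_le_ofDigits hq hd (boxCount_pos (by lia))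
          (hAvalue ▸ hlt)
      have hrest := ofDigits_val_qSubBorrow_add hd hAd hlen zero_le_one hlt
      have hcount := largeCount_eq_add q k η (c := c) (by lia)
      obtain ⟨D, x, hval, hform, hrank⟩ := ih (j := j + 1) (by lia)
        (isDigits_val_qSubBorrow A 0 hd) (by lia)
      exact ⟨D, x, hval, hform, by lia⟩

theorem exists_val_algorithmC {n i : ℕ} (hq : 1 < q) (hi : i < (boxPoly k (n - k)).eval q) :
    ∃ D x, (algorithmC q n k (Nat.digits q i)).val = some (D, x) ∧ IsForm q k (n - k) D x ∧
      formRank q k (n - k) D x = i := by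
  have htop := largeCount_top q k (n - k)
  have hcount : largeCount q k (n - k) 0 = (boxPoly k (n - k)).eval q := by
    rw [← sum_boxCount_mul_pow, largeCount, Finset.range_eq_Ico]
  have hsearch := exists_val_searchC (j := 0) hq (isTable_buildTable hq k (n - k) _) (zero_add _)
    (isDigits_digits hq i) (by rwa [htop, hcount, zero_add, Nat.ofDigits_digits])
  rwa [htop, zero_add, Nat.ofDigits_digits] at hsearch

end Search

end Counted

/-! ## Running time -/

namespace Counted

section SearchCost

variable {q k η N L W : ℕ} {T : Table} {m j a S : ℕ}

theorem cost_lookupN_le (hL : ∀ a ≤ N + 1, idxLen q a ≤ L)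
    (hW : ∀ a b c, a ≤ k → b ≤ η → c ≤ N → (T (a, b, c)).length ≤ W) (hη : η ≤ N) (hm : m ≤ N)
    (hj : j ≤ N) (hSa : S + a ≤ N) (ha : a ≤ k) :
    (lookupN q η T m j S a).cost ≤ 11 * L + W + 5 ∧
      (lookupN q η T m j S a).val.length ≤ W := by
  have := hL S (by lia)
  have := hL a (by lia)
  have := hL m (by lia)
  have := hL (S + a) (by lia)
  by_cases h : m < S + a
  · simp [lookupN, idxAdd, idxLt, h]
    lia
  · have := hL η (by lia)
    have := hL j (by lia)
    have := hL (η - j) (by lia)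
    have := hL (m - (S + a)) (by lia)
    have := hW a (η - j) (m - (S + a)) ha (by lia) (by lia)
    simp [lookupN, idxAdd, idxLt, idxSub, readCell, addrCost, h]
    lia

theorem val_fst_whileB_le (q η : ℕ) (T : Table) (m j S a : ℕ) (h : List ℕ) :
    (whileB q η T m j S a h).val.1 ≤ a := by
  induction a generalizing h with
  | zero => rfl
  | succ a ih =>
    simp only [whileB, val_bind]
    split_ifs
    · exact le_rfl
    · exact (ih _).trans a.le_succ

theorem length_val_snd_whileB (q η : ℕ) (T : Table) (m j S a : ℕ) (h : List ℕ) :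
    (whileB q η T m j S a h).val.2.length = h.length := by
  induction a generalizing h with
  | zero => rfl
  | succ a ih =>
    simp only [whileB, val_bind]
    split_ifs
    · rfl
    · exact (ih _).trans (length_val_qSubBorrow q h _ 0)

theorem cost_whileB_le (hL : ∀ a ≤ N + 1, idxLen q a ≤ L)
    (hW : ∀ a b c, a ≤ k → b ≤ η → c ≤ N → (T (a, b, c)).length ≤ W) (hη : η ≤ N) (hm : m ≤ N)
    (hj : j ≤ N) (hSa : S + a ≤ N) (ha : a ≤ k) (h : List ℕ) :
    (whileB q η T m j S a h).cost ≤ (a + 1) * (13 * L + 2 * W + 2 * h.length + 6) := by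
  induction a generalizing h with
  | zero =>
    obtain ⟨hcost, hlen⟩ := cost_lookupN_le hL hW hη hm hj hSa ha
    have := cost_qLess_le h (lookupN q η T m j S 0).val
    simp only [whileB, cost_bind, cost_pure]
    lia
  | succ a ih =>
    obtain ⟨hcost, hlen⟩ := cost_lookupN_le hL hW hη hm hj hSa ha
    set V := lookupN q η T m j S (a + 1) with hV
    have hless := cost_qLess_le h V.val
    have hsub : (qSub q h V.val).cost = h.length := cost_qSubBorrow q h V.val 0
    have hrest := ih (by lia) (by lia) (qSub q h V.val).val
    rw [qSub, length_val_qSubBorrow, ← qSub] at hrest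
    have := hL (a + 1) (by lia)
    have := hL 1 (by lia)
    simp only [whileB, cost_bind, ← hV]
    split_ifs
    · rw [cost_pure, add_one_mul]
      lia
    · simp only [cost_bind, idxSub]
      rw [add_one_mul (a + 1)]
      lia

theorem cost_columnsB_le (hL : ∀ a ≤ N + 1, idxLen q a ≤ L)
    (hW : ∀ a b c, a ≤ k → b ≤ η → c ≤ N → (T (a, b, c)).length ≤ W) (hη : η ≤ N) (hm : m ≤ N)
    {count : ℕ} (hj : j + count = η + 1) (hSa : S + count * a ≤ N) (ha : a ≤ k) (h : List ℕ) :
    (columnsB q η T m count j a S h).cost ≤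
      count * ((k + 1) * (13 * L + 2 * W + 2 * h.length + 6) + (9 * L + 5)) := by
  induction count generalizing j a S h with
  | zero => simp [columnsB]
  | succ c ih =>
    rw [add_one_mul] at hSa
    have := hL j (by lia)
    have := hL 1 (by lia)
    have := hL η (by lia)
    have := hL (j + 1) (by lia)
    have := hL S (by lia)
    have := hL m (by lia)
    simp only [columnsB, cost_bind, idxAdd, idxLt, idxEq, decide_eq_true_eq]
    rw [add_one_mul c]
    split_ifs
    · have := ih (j := j + 1) (a := 0) (S := S) (by lia) (by lia) k.zero_le h
      have := hL 0 (by lia)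
      simp only [cost_bind, cost_pure, idxWrite]
      lia
    · have hheight := val_fst_whileB_le q η T m j S a h
      have hlen := length_val_snd_whileB q η T m j S a h
      have hwhile := (cost_whileB_le (j := j) (S := S) hL hW hη hm (by lia) (by lia) ha h).trans
        (Nat.mul_le_mul_right _ (Nat.succ_le_succ ha))
      set w := whileB q η T m j S a h
      have hheights : c * w.val.1 ≤ c * a := Nat.mul_le_mul_left c hheight
      have hrest := ih (j := j + 1) (S := S + w.val.1) (by lia) (by lia) (hheight.trans ha)
        w.val.2
      rw [hlen] at hrest
      have := hL w.val.1 (by lia)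
      simp only [cost_bind, cost_pure, idxWrite]
      lia

theorem cost_algorithmB_le (hL : ∀ a ≤ N + 1, idxLen q a ≤ L)
    (hW : ∀ a b c, a ≤ k → b ≤ η → c ≤ N → (T (a, b, c)).length ≤ W) (hη : η ≤ N) (hm : m ≤ N)
    (hkη : η * k ≤ N) (h : List ℕ) :
    (algorithmB q k η T m h).cost ≤
      η * ((k + 1) * (13 * L + 2 * W + 2 * h.length + 6) + (9 * L + 5)) := by
  cases η with
  | zero => simp [algorithmB]
  | succ c =>
    rw [add_one_mul] at hkη
    have hheight := val_fst_whileB_le q (c + 1) T m 1 0 k h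
    have hlen := length_val_snd_whileB q (c + 1) T m 1 0 k h
    have hwhile := cost_whileB_le (j := 1) (S := 0) hL hW hη hm (by lia) (by lia) le_rfl h
    set w := whileB q (c + 1) T m 1 0 k h with hw
    have hheights : c * w.val.1 ≤ c * k := Nat.mul_le_mul_left c hheight
    have hrest := cost_columnsB_le (j := 2) (S := w.val.1) (count := c) hL hW hη hm (by lia)
      (by lia) hheight w.val.2
    rw [hlen] at hrest
    have := hL w.val.1 (by lia)
    simp only [algorithmB, cost_bind, cost_pure, ← hw, idxWrite]
    rw [add_one_mul c]
    lia

theorem cost_searchC_le (hL : ∀ a ≤ N + 1, idxLen q a ≤ L)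
    (hW : ∀ a b c, a ≤ k → b ≤ η → c ≤ N → (T (a, b, c)).length ≤ W) (hk : k ≤ N) (hη : η ≤ N)
    (hkη : η * k ≤ N) {count : ℕ} (hj : j + count = N + 1) (y : List ℕ) :
    (searchC q k η N T count j y).cost ≤
      count * (9 * L + 3 * W + 2 * N + 2 * y.length + 4) + (2 * N +
        η * ((k + 1) * (13 * L + 2 * W + 2 * y.length + 6) + (9 * L + 5))) := by
  induction count generalizing j y with
  | zero => simp [searchC]
  | succ c ih =>
    have hc : N - j = c := by lia
    have := hL N (by lia)
    have := hL j (by lia)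
    have := hL k (by lia)
    have := hL η (by lia)
    have := hL c (by lia)
    have hcell := hW k η c le_rfl le_rfl (by lia)
    set A := (qShift c (T (k, η, c))).val with hA
    have hAlen : A.length = c + (T (k, η, c)).length := by simp [hA, qShift]
    have hless := cost_qLess_le y A
    simp only [searchC, cost_bind, idxSub, readCell, addrCost, hc, ← hA]
    rw [add_one_mul c]
    split_ifs
    · have hB := cost_algorithmB_le (m := c) hL hW hη (by lia) hkη (qDivPow c y).val
      have hdiv : (qDivPow c y).val.length ≤ y.length := by simp [qDivPow]
      have hmono : η * ((k + 1) * (13 * L + 2 * W + 2 * (qDivPow c y).val.length + 6) +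
          (9 * L + 5)) ≤ η * ((k + 1) * (13 * L + 2 * W + 2 * y.length + 6) + (9 * L + 5)) := by
        gcongr
      have hmod : (qModPow c y).val.length = c := by
        simp [qModPow]
        lia
      simp only [cost_bind, cost_pure, qReverse, hmod, show (qShift c (T (k, η, c))).cost =
        c + (T (k, η, c)).length from rfl, show (qDivPow c y).cost = y.length from rfl,
        show (qModPow c y).cost = c from rfl]
      lia
    · have hsub : (qSub q y A).cost = y.length := cost_qSubBorrow q y A 0
      have hrest := ih (j := j + 1) (by lia) (qSub q y A).val
      rw [qSub, length_val_qSubBorrow, ← qSub] at hrest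
      have := hL 1 (by lia)
      have := hL (j + 1) (by lia)
      simp only [cost_bind, idxAdd, idxLt, hsub, show (qShift c (T (k, η, c))).cost =
        c + (T (k, η, c)).length from rfl]
      lia

end SearchCost

end Counted

theorem length_digits_le_of_lt_two_pow {q : ℕ} (hq : 1 < q) {a t : ℕ} (h : a < 2 ^ t) :
    (Nat.digits q a).length ≤ t :=
  (Nat.digits_length_le_iff hq a).2 (h.trans_le (Nat.pow_le_pow_left hq t))

theorem sq_mul_sqrt_add_one_le {a b : ℕ} (ha : 0 < a) (hb : 0 < b) :
    (((a * b) ^ 2 * (Nat.sqrt (a * b) + 1) : ℕ) : ℝ) ≤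
      2 * ((a : ℝ) ^ (5 / 2 : ℝ) * (b : ℝ) ^ (5 / 2 : ℝ)) := by
  have hab : (1 : ℝ) ≤ (a * b : ℕ) := mod_cast Nat.mul_pos ha hb
  have hsqrt : (Nat.sqrt (a * b) : ℝ) + 1 ≤ 2 * √(a * b : ℕ) := by
    linarith [Real.nat_sqrt_le_real_sqrt (a := a * b), Real.one_le_sqrt.2 hab]
  calc (((a * b) ^ 2 * (Nat.sqrt (a * b) + 1) : ℕ) : ℝ)
    _ = (a * b : ℕ) ^ 2 * (Nat.sqrt (a * b) + 1) := by push_cast; ring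
    _ ≤ (a * b : ℕ) ^ 2 * (2 * √(a * b : ℕ)) := by gcongr
    _ = 2 * ((a * b : ℕ) : ℝ) ^ (2 + 1 / 2 : ℝ) := by
        rw [Real.rpow_add (by linarith), Real.rpow_two, ← Real.sqrt_eq_rpow]
        ring
    _ = 2 * ((a : ℝ) ^ (5 / 2 : ℝ) * (b : ℝ) ^ (5 / 2 : ℝ)) := by
        rw [← Real.mul_rpow (Nat.cast_nonneg a) (Nat.cast_nonneg b), ← Nat.cast_mul]
        norm_num

namespace Counted

/-- The bound for the cost of `buildTable` with a `k × η` box when the indices and the partition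
numbers have at most `L` and `W` digits. -/
def tableBound (k η L W : ℕ) : ℕ :=
  (k + 1) * ((η + 1) * ((k * η + 1) * (20 * L + 5 * W + 12 + (4 * L + 2)) + (4 * L + 2)) +
    (4 * L + 2))

/-- The bound for the cost of `searchC` with a `k × η` box when the indices, the partition numbers
and the input have at most `L`, `W` and `ℓ` digits. -/
def searchBound (k η L W ℓ : ℕ) : ℕ :=
  (k * η + 1) * (9 * L + 3 * W + 2 * (k * η) + 2 * ℓ + 4) + (2 * (k * η) +
    η * ((k + 1) * (13 * L + 2 * W + 2 * ℓ + 6) + (9 * L + 5)))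

theorem cost_algorithmC_le_add {q n k L W : ℕ} (hq : 1 < q) (hk : 0 < k) (hkn : k < n)
    (hL : ∀ a ≤ k * (n - k) + 1, idxLen q a ≤ L)
    (hW : ∀ a b c, c ≤ k * (n - k) → (Nat.digits q (boxCount a b c)).length ≤ W) (y : List ℕ) :
    (algorithmC q n k y).cost ≤ 2 * L + 1 + 2 * (L + 1) * (L + 1) + tableBound k (n - k) L W +
      searchBound k (n - k) L W y.length := by
  have hkN : k ≤ k * (n - k) := Nat.le_mul_of_pos_right k (by lia)
  have hηN : n - k ≤ k * (n - k) := Nat.le_mul_of_pos_left _ hk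
  have hnN : n ≤ k * (n - k) + 1 := by
    obtain ⟨η, hη, rfl⟩ : ∃ η, 0 < η ∧ n = k + η := ⟨n - k, by lia, by lia⟩
    rw [Nat.add_sub_cancel_left]
    nlinarith
  have hmul : 2 * (idxLen q k + 1) * (idxLen q (n - k) + 1) ≤ 2 * (L + 1) * (L + 1) := by
    gcongr <;> exact hL _ (by lia)
  have htable := cost_buildTable_le (k := k) (η := n - k) hq (fun a ha => hL a (by lia)) hW
  have hcells := isTable_buildTable hq k (n - k) (k * (n - k))
  have hsearch := cost_searchC_le (j := 0) hL
    (fun a b c ha hb hc => hcells a b c ha hb hc ▸ hW a b c hc) hkN hηN (mul_comm _ _).le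
    (zero_add _) y
  have := hL n hnN
  have := hL k (by lia)
  simp only [algorithmC, cost_bind, idxSub, idxMul, tableBound, searchBound]
  lia

section Estimates

variable {k η s ℓ : ℕ}

theorem tableBound_le (hk : 0 < k) (hη : 0 < η) (hs : 0 < s) :
    tableBound k η (2 * s) (13 * s) ≤ 1076 * ((k * η) ^ 2 * s) := by
  have hN : 0 < k * η := Nat.mul_pos hk hη
  have hrow : (k * η + 1) * (20 * (2 * s) + 5 * (13 * s) + 12 + (4 * (2 * s) + 2)) +
      (4 * (2 * s) + 2) ≤ 264 * (k * η * s) := by nlinarith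
  calc tableBound k η (2 * s) (13 * s)
    _ ≤ 2 * k * (2 * η * (264 * (k * η * s)) + 10 * (η * (k * η * s))) := by
        unfold tableBound
        gcongr
        · lia
        · lia
        · nlinarith
    _ = 1076 * ((k * η) ^ 2 * s) := by ring

theorem searchBound_le (hk : 0 < k) (hη : 0 < η) (hs : 0 < s) (hsN : s ≤ 2 * (k * η))
    (hℓ : ℓ ≤ 3 * (k * η)) :
    searchBound k η (2 * s) (13 * s) ℓ ≤ 552 * (k * η) ^ 2 := by
  have hN : 0 < k * η := Nat.mul_pos hk hη
  have hrounds : (k * η + 1) * (9 * (2 * s) + 3 * (13 * s) + 2 * (k * η) + 2 * ℓ + 4) ≤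
      260 * (k * η) ^ 2 :=
    (Nat.mul_le_mul (by lia : _ ≤ 2 * (k * η)) (by lia : _ ≤ 130 * (k * η))).trans_eq (by ring)
  have hcolumn : (k + 1) * (13 * (2 * s) + 2 * (13 * s) + 2 * ℓ + 6) + (9 * (2 * s) + 5) ≤
      290 * (k * (k * η)) :=
    calc _ ≤ 2 * k * (122 * (k * η)) + 46 * (k * (k * η)) := by
          gcongr
          · lia
          · lia
          · nlinarith
      _ = 290 * (k * (k * η)) := by ring
  have hdiagram : η * ((k + 1) * (13 * (2 * s) + 2 * (13 * s) + 2 * ℓ + 6) + (9 * (2 * s) + 5)) ≤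
      290 * (k * η) ^ 2 :=
    (Nat.mul_le_mul_left η hcolumn).trans_eq (by ring)
  have hlinear : k * η ≤ (k * η) ^ 2 := Nat.le_self_pow two_ne_zero _
  unfold searchBound
  lia

end Estimates

theorem cost_algorithmC_le {q n k i : ℕ} (hq : 1 < q) (hk : 0 < k) (hkn : k < n)
    (hi : i < (boxPoly k (n - k)).eval q) :
    (algorithmC q n k (Nat.digits q i)).cost ≤
      1669 * ((k * (n - k)) ^ 2 * (Nat.sqrt (k * (n - k)) + 1)) := by
  have hη : 0 < n - k := Nat.sub_pos_of_lt hkn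
  have hkN : k ≤ k * (n - k) := Nat.le_mul_of_pos_right k hη
  have hηN : n - k ≤ k * (n - k) := Nat.le_mul_of_pos_left _ hk
  have hℓ : (Nat.digits q i).length ≤ 3 * (k * (n - k)) :=
    ((Nat.digits_length_le_iff hq i).2 (hi.trans_le (eval_boxPoly_le hq k (n - k)))).trans (by lia)
  set N := k * (n - k)
  obtain ⟨s, hs⟩ : ∃ s, s = Nat.sqrt N + 1 := ⟨_, rfl⟩
  have hs0 : 0 < s := by lia
  have hNs : N + 1 ≤ s * s := hs ▸ Nat.lt_succ_sqrt N
  have hsN : s ≤ 2 * N := by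
    have := Nat.sqrt_le_self N
    lia
  have hidx : ∀ a ≤ N + 1, idxLen q a ≤ 2 * s := fun a ha =>
    length_digits_le_of_lt_two_pow hq <| calc
      a ≤ s * s := ha.trans hNs
      _ < 2 ^ s * 2 ^ s := Nat.mul_lt_mul'' Nat.lt_two_pow_self Nat.lt_two_pow_self
      _ = 2 ^ (2 * s) := by rw [two_mul, pow_add]
  have hbox : ∀ a b c, c ≤ N → (Nat.digits q (boxCount a b c)).length ≤ 13 * s := fun a b c hc =>
    length_digits_le_of_lt_two_pow hq <| (boxCount_le_two_pow hs0 a b (by lia)).trans_lt <|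
      Nat.pow_lt_pow_right one_lt_two (by lia)
  have hproduct : 2 * (2 * s) + 1 + 2 * (2 * s + 1) * (2 * s + 1) ≤ 41 * (N ^ 2 * s) :=
    calc _ ≤ 41 * (N * s) := by nlinarith
      _ ≤ 41 * (N ^ 2 * s) := by
          gcongr
          exact Nat.le_self_pow two_ne_zero N
  have hcost := cost_algorithmC_le_add hq hk hkn hidx hbox (Nat.digits q i)
  have htable := tableBound_le hk hη hs0
  have hsearch := searchBound_le hk hη hs0 hsN hℓ
  have hsquare : N ^ 2 ≤ N ^ 2 * s := Nat.le_mul_of_pos_right _ hs0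
  rw [← hs]
  lia

theorem cost_algorithmC_le_rpow {q n k i : ℕ} (hq : 1 < q) (hk : 0 < k) (hkn : k < n)
    (hi : i < (boxPoly k (n - k)).eval q) :
    ((algorithmC q n k (Nat.digits q i)).cost : ℝ) ≤
      3338 * (k : ℝ) ^ (5 / 2 : ℝ) * ((n - k : ℕ) : ℝ) ^ (5 / 2 : ℝ) := by
  have hcost := (Nat.cast_le (α := ℝ)).2 (cost_algorithmC_le hq hk hkn hi)
  rw [Nat.cast_mul] at hcost
  have hreal := sq_mul_sqrt_add_one_le hk (Nat.sub_pos_of_lt hkn)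
  push_cast at hcost hreal ⊢
  linarith

end Counted

theorem cast_lt_gaussCoeff_iff {q n k i : ℕ} (hq : 1 < q) (hk : k ≤ n) :
    (i : ℚ) < gaussCoeff q n k ↔ i < (boxPoly k (n - k)).eval q := by
  rw [← eval_boxPoly_eq_gaussCoeff hq hk, Nat.cast_lt]

theorem mainTheorem8 :
    ∃ C : ℝ, ∀ (F : Type*) [Field F] [Fintype F] (e : F ≃ Fin (Fintype.card F))
      (n k i : ℕ), k ≤ n → (i : ℚ) < gaussCoeff (Fintype.card F) n k →
      (∃ D x : List ℕ,
        (Counted.algorithmC (Fintype.card F) n k (Nat.digits (Fintype.card F) i)).val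
          = some (D, x) ∧
        ∃ X : Grass F n k, (∀ Y : Grass F n k, HasTableauxForm e Y D x ↔ Y = X) ∧
          indF e X = i) ∧
      (0 < k → k < n →
        ((Counted.algorithmC (Fintype.card F) n k (Nat.digits (Fintype.card F) i)).cost : ℝ)
          ≤ C * (k : ℝ) ^ (5 / 2 : ℝ) * ((n - k : ℕ) : ℝ) ^ (5 / 2 : ℝ)) := by
  refine ⟨3338, fun F _ _ e n k i hk hi => ?_⟩
  have hq : 1 < Fintype.card F := Fintype.one_lt_card
  rw [cast_lt_gaussCoeff_iff hq hk] at hi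
  refine ⟨?_, fun hk0 hkn => Counted.cost_algorithmC_le_rpow hq hk0 hkn hi⟩
  obtain ⟨D, x, hval, hform, hrank⟩ := Counted.exists_val_algorithmC hq hi
  obtain ⟨X, hX⟩ := hform.exists_hasTableauxForm e hk
  refine ⟨D, x, hval, X, fun Y => ⟨fun hY => hY.subspace_unique hX, fun hY => hY ▸ hX⟩, ?_⟩
  rw [indF_eq_formRank hq hk hX, hrank]
  intro j hj
  obtain ⟨D', x', -, hform', hrank'⟩ :=
    Counted.exists_val_algorithmC hq ((hj.trans_eq hrank).trans hi)
  exact ⟨D', x', hform', hrank'⟩
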